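/- Let $\Bbbk$ be a field of characteristic $0$, let $g,s$ be natural numbers, and let $\Bbbk\langle x\rangle$ be the free (unital associative) $\Bbbk$-algebra on $x=(x_1,\dots,x_g)$. Let $Y=(Y_1,\dots,Y_g)$ be a semisimple $g$-tuple of $s\times s$ matrices over $\Bbbk$, i.e., every subspace of $\Bbbk^s$ invariant under all $Y_j$ has a complementary subspace invariant under all $Y_j$. For a $g$-tuple $Z$ and a matrix $S$ in $M_s(\Bbbk)$ write $SZ=(SZ_j)_j$, $ZS=(Z_jS)_j$ and $[S,Z]=SZ-ZS$. A *formal nc germ about $Y$* is a sequence $(f_\ell)_{\ell\ge0}$ of $\ell$-linear maps $f_\ell:(M_s(\Bbbk)^g)^\ell\to M_s(\Bbbk)$ such that $f_1([S,Y])=[S,f_0]$ and, for all $\ell\ge2$, $1\le j\le \ell-2$, $S\in M_s(\Bbbk)$ and $Z^i\in M_s(\Bbbk)^g$, $$f_\ell([S,Y],Z^1,\dots,Z^{\ell-1})=Sf_{\ell-1}(Z^1,\dots,Z^{\ell-1})-f_{\ell-1}(SZ^1,Z^2,\dots,Z^{\ell-1}),$$ $$f_\ell(\dots,Z^j,[S,Y],Z^{j+1},\dots)=f_{\ell-1}(\dots,Z^jS,Z^{j+1},\dots)-f_{\ell-1}(\dots,Z^j,SZ^{j+1},\dots),$$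 $$f_\ell(Z^1,\dots,Z^{\ell-1},[S,Y])=f_{\ell-1}(Z^1,\dots,Z^{\ell-2},Z^{\ell-1}S)-f_{\ell-1}(Z^1,\dots,Z^{\ell-1})S.$$ With termwise addition and the convolution product $(fh)_n(Z^1,\dots,Z^n)=\sum_{i=0}^n f_i(Z^1,\dots,Z^i)\,h_{n-i}(Z^{i+1},\dots,Z^n)$, the formal nc germs about $Y$ form a $\Bbbk$-algebra $\mathcal O_Y$. For $p\in\Bbbk\langle x\rangle$ and $Z^1,\dots,Z^\ell\in M_s(\Bbbk)^g$, let $B(Z^1,\dots,Z^\ell)$ be the $g$-tuple of $(\ell+1)\times(\ell+1)$ block matrices with diagonal blocks $Y$, blocks $Z^1,\dots,Z^\ell$ on the first superdiagonal, and zeros elsewhere, and let $\Delta^\ell_Yp(Z^1,\dots,Z^\ell)$ be the top right block of $p(B(Z^1,\dots,Z^\ell))$. Let $$\mathcal I(Y)=\{p\in\Bbbk\langle x\rangle: p(Y)=0\},\qquad \mathcal I_\ell(Y)=\{p\in\Bbbk\langle x\rangle: p(B(Z^1,\dots,Z^\ell))=0\ \text{ for all } Z^1,\dots,Z^\ell\in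 M_s(\Bbbk)^g\},$$ so that $\mathcal I_0(Y)=\mathcal I(Y)$. Then: 1. $\mathcal I_\ell(Y)=\mathcal I(Y)^{\ell+1}$ for all $\ell\ge0$. 2. $\mathcal O_Y\cong\varprojlim_\ell \Bbbk\langle x\rangle/\mathcal I(Y)^\ell$ canonically: there is a $\Bbbk$-algebra isomorphism $\Phi:\mathcal O_Y\to\varprojlim_\ell\Bbbk\langle x\rangle/\mathcal I(Y)^\ell$ such that for all $f\in\mathcal O_Y$, $\ell\ge0$ and $p\in\Bbbk\langle x\rangle$, the $\ell$-th component of $\Phi(f)$ is the class of $p$ if and only if $f_m=\Delta^m_Yp$ for all $m<\ell$. In particular, $\Phi$ sends the germ $(\Delta^\ell_Yp)_\ell$ of a polynomial $p$ to the family of the classes of $p$. -/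

import Mathlib

namespace FreeAnalysis

/-! ### Sequences of multilinear maps with the convolution product -/

section Series

variable {k V A : Type*} [CommRing k] [AddCommGroup V] [Module k V] [Ring A] [Algebra k A]

variable (k V A) in
/-- Sequences `(f_ℓ)_{ℓ ≥ 0}` of `ℓ`-linear maps `f_ℓ : V^ℓ → A`. -/
def MultiSeq : Type _ := (ℓ : ℕ) → MultilinearMap k (fun _ : Fin ℓ => V) A

namespace MultiSeq

instance : AddCommGroup (MultiSeq k V A) :=
  inferInstanceAs (AddCommGroup ((ℓ : ℕ) → MultilinearMap k (fun _ : Fin ℓ => V) A))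

instance : Module k (MultiSeq k V A) :=
  inferInstanceAs (Module k ((ℓ : ℕ) → MultilinearMap k (fun _ : Fin ℓ => V) A))

/-- The `n`-linear map
`(Z^1, …, Z^n) ↦ f_i (Z^1, …, Z^i) * h_{n-i} (Z^{i+1}, …, Z^n)`. -/
def splitMul (f h : MultiSeq k V A) (n : ℕ) (i : Fin (n + 1)) :
    MultilinearMap k (fun _ : Fin n => V) A :=
  MultilinearMap.mk'
    (fun Z => f i (fun a : Fin i => Z ⟨a, by omega⟩) *
      h (n - i) (fun b : Fin (n - i) => Z ⟨i + b, by omega⟩))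
    (by
      intro Z m x y
      have hl : ∀ (hm : m.1 < i.1) (v : V),
          (fun a : Fin i => Function.update Z m v ⟨a, by omega⟩) =
            Function.update (fun a : Fin i => Z ⟨a, by omega⟩) ⟨m, hm⟩ v := by
        intro hm v; ext a; simp [Function.update_apply, Fin.ext_iff]
      have hl' : ∀ (hm : m.1 < i.1) (v : V),
          (fun b : Fin (n - i) => Function.update Z m v ⟨i + b, by omega⟩) =
            (fun b : Fin (n - i) => Z ⟨i + b, by omega⟩) := by
        intro hm v; ext b; rw [Function.update_of_ne]; simp [Fin.ext_iff]; omega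
      have hr : ∀ (_ : ¬ m.1 < i.1) (v : V),
          (fun a : Fin i => Function.update Z m v ⟨a, by omega⟩) =
            (fun a : Fin i => Z ⟨a, by omega⟩) := by
        intro hm v; ext a; rw [Function.update_of_ne]; simp [Fin.ext_iff]; omega
      have hr' : ∀ (hm : ¬ m.1 < i.1) (v : V),
          (fun b : Fin (n - i) => Function.update Z m v ⟨i + b, by omega⟩) =
            Function.update (fun b : Fin (n - i) => Z ⟨i + b, by omega⟩)
              ⟨m - i, by omega⟩ v := by
        intro hm v; ext b
        have : (i.1 + b.1 = m.1) ↔ b.1 = m.1 - i.1 := by omega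
        simp [Function.update_apply, Fin.ext_iff, this]
      by_cases hm : m.1 < i.1
      · simp only [hl hm, hl' hm, MultilinearMap.map_update_add, add_mul]
      · simp only [hr hm, hr' hm, MultilinearMap.map_update_add, mul_add])
    (by
      intro Z m c x
      have hl : ∀ (hm : m.1 < i.1) (v : V),
          (fun a : Fin i => Function.update Z m v ⟨a, by omega⟩) =
            Function.update (fun a : Fin i => Z ⟨a, by omega⟩) ⟨m, hm⟩ v := by
        intro hm v; ext a; simp [Function.update_apply, Fin.ext_iff]
      have hl' : ∀ (hm : m.1 < i.1) (v : V),
          (fun b : Fin (n - i) => Function.update Z m v ⟨i + b, by omega⟩) =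
            (fun b : Fin (n - i) => Z ⟨i + b, by omega⟩) := by
        intro hm v; ext b; rw [Function.update_of_ne]; simp [Fin.ext_iff]; omega
      have hr : ∀ (_ : ¬ m.1 < i.1) (v : V),
          (fun a : Fin i => Function.update Z m v ⟨a, by omega⟩) =
            (fun a : Fin i => Z ⟨a, by omega⟩) := by
        intro hm v; ext a; rw [Function.update_of_ne]; simp [Fin.ext_iff]; omega
      have hr' : ∀ (hm : ¬ m.1 < i.1) (v : V),
          (fun b : Fin (n - i) => Function.update Z m v ⟨i + b, by omega⟩) =
            Function.update (fun b : Fin (n - i) => Z ⟨i + b, by omega⟩)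
              ⟨m - i, by omega⟩ v := by
        intro hm v; ext b
        have : (i.1 + b.1 = m.1) ↔ b.1 = m.1 - i.1 := by omega
        simp [Function.update_apply, Fin.ext_iff, this]
      by_cases hm : m.1 < i.1
      · simp only [hl hm, hl' hm, MultilinearMap.map_update_smul, smul_mul_assoc]
      · simp only [hr hm, hr' hm, MultilinearMap.map_update_smul, mul_smul_comm])

/-- Convolution product:
`(f h)_n (Z^1, …, Z^n) = ∑_{i=0}^n f_i (Z^1, …, Z^i) h_{n-i} (Z^{i+1}, …, Z^n)`. -/
instance : Mul (MultiSeq k V A) := ⟨fun f h n => ∑ i : Fin (n + 1), splitMul f h n i⟩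

/-- The unit is the sequence `(1, 0, 0, …)`. -/
instance : One (MultiSeq k V A) :=
  ⟨fun ℓ => match ℓ with
    | 0 => MultilinearMap.constOfIsEmpty k (fun _ : Fin 0 => V) 1
    | _ + 1 => 0⟩

/-- Evaluation of `f_n` on the first `n` terms of an infinite sequence of vectors. -/
def app (f : MultiSeq k V A) (n : ℕ) (z : ℕ → V) : A := f n (fun i => z i)

theorem ext_app {f h : MultiSeq k V A} (H : ∀ n z, app f n z = app h n z) : f = h := by
  funext n
  ext Z
  have := H n (fun i => if hi : i < n then Z ⟨i, hi⟩ else 0)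
  simpa [app] using this

theorem app_add (f h : MultiSeq k V A) (n : ℕ) (z : ℕ → V) :
    app (f + h) n z = app f n z + app h n z := rfl

theorem app_zero (n : ℕ) (z : ℕ → V) : app (0 : MultiSeq k V A) n z = 0 := rfl

theorem app_smul (c : k) (f : MultiSeq k V A) (n : ℕ) (z : ℕ → V) :
    app (c • f) n z = c • app f n z := rfl

theorem app_one (n : ℕ) (z : ℕ → V) :
    app (1 : MultiSeq k V A) n z = if n = 0 then 1 else 0 := by
  cases n <;> rfl

theorem app_mul (f h : MultiSeq k V A) (n : ℕ) (z : ℕ → V) :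
    app (f * h) n z =
      ∑ i ∈ Finset.range (n + 1), app f i z * app h (n - i) (fun b => z (i + b)) := by
  rw [Finset.sum_range]
  change (∑ i : Fin (n + 1), splitMul f h n i) _ = _
  rw [_root_.sum_apply]
  rfl

theorem one_mul' (f : MultiSeq k V A) : 1 * f = f := by
  refine ext_app fun n z => ?_
  rw [app_mul, Finset.sum_eq_single 0]
  · simp [app_one]
  · intro b _ hb; simp [app_one, hb]
  · simp

theorem mul_one' (f : MultiSeq k V A) : f * 1 = f := by
  refine ext_app fun n z => ?_
  rw [app_mul, Finset.sum_eq_single n]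
  · simp [app_one]
  · intro b hb hb'
    have : n - b ≠ 0 := by have := Finset.mem_range.1 hb; omega
    simp [app_one, this]
  · simp

theorem mul_assoc' (f h l : MultiSeq k V A) : f * h * l = f * (h * l) := by
  refine ext_app fun n z => ?_
  simp only [app_mul, Finset.sum_mul, Finset.mul_sum]
  rw [Finset.sum_sigma', Finset.sum_sigma']
  refine Finset.sum_bij' (fun x _ => ⟨x.2, x.1 - x.2⟩) (fun x _ => ⟨x.1 + x.2, x.1⟩)
    ?_ ?_ ?_ ?_ ?_
  · rintro ⟨i, j⟩ hx
    simp only [Finset.mem_sigma, Finset.mem_range] at hx ⊢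
    omega
  · rintro ⟨i, j⟩ hx
    simp only [Finset.mem_sigma, Finset.mem_range] at hx ⊢
    omega
  · rintro ⟨i, j⟩ hx
    simp only [Finset.mem_sigma, Finset.mem_range] at hx
    have : j + (i - j) = i := by omega
    simp [this]
  · rintro ⟨i, j⟩ hx
    simp
  · rintro ⟨i, j⟩ hx
    simp only [Finset.mem_sigma, Finset.mem_range] at hx
    have h1 : n - j - (i - j) = n - i := by omega
    have h2 : ∀ b, j + (i - j + b) = i + b := by intro b; omega
    simp only [h1, h2, mul_assoc]

instance : Ring (MultiSeq k V A) :=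
  { (inferInstance : AddCommGroup (MultiSeq k V A)) with
    mul := (· * ·)
    one := 1
    one_mul := one_mul'
    mul_one := mul_one'
    mul_assoc := mul_assoc'
    left_distrib := fun f h l => ext_app fun n z => by
      simp only [app_mul, app_add, mul_add, Finset.sum_add_distrib]
    right_distrib := fun f h l => ext_app fun n z => by
      simp only [app_mul, app_add, add_mul, Finset.sum_add_distrib]
    zero_mul := fun f => ext_app fun n z => by simp [app_mul, app_zero]
    mul_zero := fun f => ext_app fun n z => by simp [app_mul, app_zero] }

instance : Algebra k (MultiSeq k V A) :=
  Algebra.ofModule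
    (fun c f h => ext_app fun n z => by
      simp only [app_mul, app_smul, Finset.smul_sum, smul_mul_assoc])
    (fun c f h => ext_app fun n z => by
      simp only [app_mul, app_smul, Finset.smul_sum, mul_smul_comm])

end MultiSeq

end Series

/-! ### Matrix points -/

section Points

variable {k : Type*} [Field k] {g s : ℕ}

variable (k g s) in
/-- `g`-tuples of `s × s` matrices over `k`. -/
abbrev Point : Type _ := Fin g → Matrix (Fin s) (Fin s) k

/-- `Y` is semisimple: every subspace of `k^s` that is invariant under all `Y_j` has a
complementary subspace that is invariant under all `Y_j`. -/
def IsSemisimplePoint (Y : Point k g s) : Prop :=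
  ∀ W : Submodule k (Fin s → k), (∀ j, ∀ w ∈ W, (Y j).mulVec w ∈ W) →
    ∃ W' : Submodule k (Fin s → k), (∀ j, ∀ w ∈ W', (Y j).mulVec w ∈ W') ∧ IsCompl W W'

/-- `[S, Y] = (S Y_j - Y_j S)_j`. -/
def comm (S : Matrix (Fin s) (Fin s) k) (Y : Point k g s) : Point k g s :=
  fun j => S * Y j - Y j * S

/-- `S Z = (S Z_j)_j`. -/
def lmul (S : Matrix (Fin s) (Fin s) k) (Z : Point k g s) : Point k g s := fun j => S * Z j

/-- `Z S = (Z_j S)_j`. -/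
def rmul (Z : Point k g s) (S : Matrix (Fin s) (Fin s) k) : Point k g s := fun j => Z j * S

/-- The intertwining conditions `LAC(Y)` with respect to `Y`. In `middle`, the commutator is placed between
two consecutive arguments `Z j.castSucc` and `Z j.succ`. -/
structure LAC (Y : Point k g s) (f : MultiSeq k (Point k g s) (Matrix (Fin s) (Fin s) k)) :
    Prop where
  one : ∀ S : Matrix (Fin s) (Fin s) k, f 1 ![comm S Y] = S * f 0 ![] - f 0 ![] * S
  first : ∀ (n : ℕ) (S : Matrix (Fin s) (Fin s) k) (Z : Fin (n + 1) → Point k g s),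
    f (n + 2) (Fin.cons (comm S Y) Z) =
      S * f (n + 1) Z - f (n + 1) (Function.update Z 0 (lmul S (Z 0)))
  middle : ∀ (n : ℕ) (j : Fin n) (S : Matrix (Fin s) (Fin s) k) (Z : Fin (n + 1) → Point k g s),
    f (n + 2) (j.succ.castSucc.insertNth (comm S Y) Z) =
      f (n + 1) (Function.update Z j.castSucc (rmul (Z j.castSucc) S)) -
        f (n + 1) (Function.update Z j.succ (lmul S (Z j.succ)))
  last : ∀ (n : ℕ) (S : Matrix (Fin s) (Fin s) k) (Z : Fin (n + 1) → Point k g s),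
    f (n + 2) (Fin.snoc Z (comm S Y)) =
      f (n + 1) (Function.update Z (Fin.last n) (rmul (Z (Fin.last n)) S)) - f (n + 1) Z * S

/-- Insert `v` at position `p` of the sequence `z`. -/
def ins {V : Type*} (p : ℕ) (v : V) (z : ℕ → V) : ℕ → V :=
  fun i => if i < p then z i else if i = p then v else z (i - 1)

/-- The conditions `LAC(Y)`, written uniformly in terms of infinite sequences of arguments. -/
theorem lac_iff_app (Y : Point k g s)
    (f : MultiSeq k (Point k g s) (Matrix (Fin s) (Fin s) k)) :
    LAC Y f ↔ ∀ (n p : ℕ) (_ : p ≤ n) (S : Matrix (Fin s) (Fin s) k) (z : ℕ → Point k g s),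
      f.app (n + 1) (ins p (comm S Y) z) =
        (if p = 0 then S * f.app n z
          else f.app n (Function.update z (p - 1) (rmul (z (p - 1)) S))) -
        (if p = n then f.app n z * S
          else f.app n (Function.update z p (lmul S (z p)))) := by
  have hupd : ∀ (n : ℕ) (j : Fin n) (z : ℕ → Point k g s) (v : Point k g s),
      (fun i : Fin n => Function.update z j.1 v i.1) =
        Function.update (fun i : Fin n => z i) j v := by
    intro n j z v; funext i; simp [Function.update_apply, Fin.ext_iff]
  have hcons : ∀ (n : ℕ) (z : ℕ → Point k g s) (v : Point k g s),
      (fun i : Fin (n + 1) => ins 0 v z i.1) = Fin.cons v (fun i : Fin n => z i) := by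
    intro n z v; funext i; refine Fin.cases ?_ (fun i => ?_) i <;> simp [ins]
  have hsnoc : ∀ (n : ℕ) (z : ℕ → Point k g s) (v : Point k g s),
      (fun i : Fin (n + 1) => ins n v z i.1) = Fin.snoc (fun i : Fin n => z i) v := by
    intro n z v; funext i; refine Fin.lastCases ?_ (fun i => ?_) i <;> simp [ins]
  have hins : ∀ (n : ℕ) (j : Fin n) (z : ℕ → Point k g s) (v : Point k g s),
      (fun i : Fin (n + 2) => ins (j.1 + 1) v z i.1) =
        j.succ.castSucc.insertNth v (fun i : Fin (n + 1) => z i) := by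
    intro n j z v
    rw [Fin.eq_insertNth_iff]
    refine ⟨by simp [ins], ?_⟩
    funext i
    by_cases h : i.1 < j.1 + 1
    · have : j.succ.castSucc.succAbove i = i.castSucc :=
        Fin.succAbove_of_castSucc_lt _ _ (by simpa [Fin.lt_def] using h)
      change ins (j.1 + 1) v z (j.succ.castSucc.succAbove i).1 = z i
      rw [this]
      simp only [ins, Fin.val_castSucc, if_pos h]
    · have : j.succ.castSucc.succAbove i = i.succ :=
        Fin.succAbove_of_le_castSucc _ _ (by simp [Fin.le_def]; omega)
      have h1 : ¬ (i.1 < j.1) := by omega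
      have h2 : ¬ (i.1 = j.1) := by omega
      change ins (j.1 + 1) v z (j.succ.castSucc.succAbove i).1 = z i
      rw [this]
      simp [ins, h1, h2]
  have hext : ∀ (n : ℕ) (Z : Fin n → Point k g s),
      ∃ z : ℕ → Point k g s, Z = fun i : Fin n => z i := by
    intro n Z
    exact ⟨fun i => if hi : i < n then Z ⟨i, hi⟩ else 0, by funext i; simp⟩
  constructor
  · intro h n p hp S z
    rcases n with _ | n
    · obtain rfl : p = 0 := by omega
      have := h.one S
      simp only [MultiSeq.app, if_true]
      convert this using 2
      · rw [hcons]; funext i; fin_cases i; rfl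
      · congr 2; exact Subsingleton.elim _ _
      · congr 2; exact Subsingleton.elim _ _
    · rcases p with _ | p
      · have := h.first n S (fun i => z i)
        have hu := hupd (n + 1) 0 z (lmul S (z 0))
        simp only [Fin.val_zero] at hu this
        simp [MultiSeq.app, hcons, this, hu]
      · by_cases hpn : p = n
        · subst hpn
          have := h.last p S (fun i => z i)
          have hu := hupd (p + 1) (Fin.last p) z (rmul (z p) S)
          simp only [Fin.val_last] at hu this
          simp [MultiSeq.app, hsnoc, this, hu]
        · have hlt : p < n := by omega
          have := h.middle n ⟨p, hlt⟩ S (fun i => z i)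
          have hi := hins n ⟨p, hlt⟩ z (comm S Y)
          have hu := hupd (n + 1) (Fin.castSucc ⟨p, hlt⟩) z (rmul (z p) S)
          have hu' := hupd (n + 1) (Fin.succ ⟨p, hlt⟩) z (lmul S (z (p + 1)))
          simp only [Fin.val_castSucc, Fin.val_succ] at hi hu hu' this
          simp only [MultiSeq.app, Nat.add_sub_cancel, hi, this, hu, hu']
          simp [hpn]
  · intro h
    refine ⟨fun S => ?_, fun n S Z => ?_, fun n j S Z => ?_, fun n S Z => ?_⟩
    · have := h 0 0 le_rfl S (fun _ => 0)
      simp only [MultiSeq.app, if_true] at this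
      convert this using 2
      · rw [hcons]; funext i; fin_cases i; rfl
      · congr 2; exact Subsingleton.elim _ _
      · congr 2; exact Subsingleton.elim _ _
    · obtain ⟨z, rfl⟩ := hext _ Z
      have := h (n + 1) 0 (by omega) S z
      have hu := hupd (n + 1) 0 z (lmul S (z 0))
      simp only [Fin.val_zero] at hu
      simpa [MultiSeq.app, hcons, hu] using this
    · obtain ⟨z, rfl⟩ := hext _ Z
      have := h (n + 1) (j.1 + 1) (by omega) S z
      have hi := hins n j z (comm S Y)
      have hu := hupd (n + 1) (Fin.castSucc j) z (rmul (z j) S)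
      have hu' := hupd (n + 1) (Fin.succ j) z (lmul S (z (j + 1)))
      simp only [Fin.val_castSucc, Fin.val_succ] at hu hu'
      have hj : j.1 ≠ n := by omega
      simpa [MultiSeq.app, hi, hu, hu', hj] using this
    · obtain ⟨z, rfl⟩ := hext _ Z
      have := h (n + 1) (n + 1) le_rfl S z
      have hu := hupd (n + 1) (Fin.last n) z (rmul (z n) S)
      simp only [Fin.val_last] at hu
      simpa [MultiSeq.app, hsnoc, hu] using this

theorem LAC.mul {Y : Point k g s}
    {f h : MultiSeq k (Point k g s) (Matrix (Fin s) (Fin s) k)} (hf : LAC Y f) (hh : LAC Y h) :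
    LAC Y (f * h) := by
  rw [lac_iff_app] at *
  intro n p hp S z
  obtain ⟨q, rfl⟩ := Nat.exists_eq_add_of_le hp
  have hcong : ∀ (u : MultiSeq k (Point k g s) (Matrix (Fin s) (Fin s) k)) (m : ℕ)
      (y y' : ℕ → Point k g s), (∀ i < m, y i = y' i) → u.app m y = u.app m y' := by
    intro u m y y' H
    unfold MultiSeq.app
    congr 1
    funext i
    exact H i i.2
  have hU1 : ∀ (m r : ℕ) (v : Point k g s), m ≤ r →
      f.app m (Function.update z r v) = f.app m z := by
    intro m r v hm
    refine hcong _ _ _ _ fun i hi => ?_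
    rw [Function.update_of_ne]; omega
  have hU2 : ∀ (m r : ℕ) (v : Point k g s), r < m →
      (fun b => Function.update z r v (m + b)) = fun b => z (m + b) := by
    intro m r v hm
    funext b
    rw [Function.update_of_ne]; omega
  have hU3 : ∀ (m r : ℕ) (v : Point k g s), m ≤ r →
      (fun b => Function.update z r v (m + b)) =
        Function.update (fun b => z (m + b)) (r - m) v := by
    intro m r v hm
    funext b
    have : m + b = r ↔ b = r - m := by omega
    simp [Function.update_apply, this]
  have hI1 : ∀ (m : ℕ) (v : Point k g s), m ≤ p → f.app m (ins p v z) = f.app m z := by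
    intro m v hm
    refine hcong _ _ _ _ fun i hi => ?_
    have : i < p := by omega
    simp [ins, this]
  have hI2 : ∀ (m : ℕ) (v : Point k g s), m ≤ p →
      (fun b => ins p v z (m + b)) = ins (p - m) v (fun b => z (m + b)) := by
    intro m v hm
    funext b
    unfold ins
    have e1 : m + b < p ↔ b < p - m := by omega
    have e2 : m + b = p ↔ b = p - m := by omega
    simp only [e1, e2]
    split_ifs with h1 h2
    · rfl
    · rfl
    · congr 1; omega
  have hI3 : ∀ (x : ℕ) (v : Point k g s),
      (fun b => ins p v z (p + 1 + x + b)) = fun b => z (p + x + b) := by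
    intro x v
    funext b
    unfold ins
    rw [if_neg (by omega), if_neg (by omega)]
    congr 1; omega
  set c := comm S Y with hc
  -- left-hand side
  have hL : (f * h).app (p + q + 1) (ins p c z) =
      (∑ i ∈ Finset.range p, f.app i z *
          (h.app (p + q - i)
            (Function.update (fun b => z (i + b)) (p - 1 - i) (rmul (z (p - 1)) S)) -
          (if p = p + q then h.app (p + q - i) (fun b => z (i + b)) * S
            else h.app (p + q - i)
              (Function.update (fun b => z (i + b)) (p - i) (lmul S (z p))))) +
        f.app p z * (S * h.app q (fun b => z (p + b)) -
          (if p = p + q then h.app (p + q - p) (fun b => z (p + b)) * S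
            else h.app (p + q - p)
              (Function.update (fun b => z (p + b)) (p - p) (lmul S (z p)))))) +
      (∑ x ∈ Finset.range (q + 1),
        ((if p = 0 then S * f.app (p + x) z
            else f.app (p + x) (Function.update z (p - 1) (rmul (z (p - 1)) S))) -
          (if x = 0 then f.app (p + x) z * S
            else f.app (p + x) (Function.update z p (lmul S (z p))))) *
          h.app (q - x) (fun b => z (p + x + b))) := by
    rw [MultiSeq.app_mul, show p + q + 1 + 1 = (p + 1) + (q + 1) by omega,
      Finset.sum_range_add, Finset.sum_range_succ]
    congr 1
    · congr 1
      · refine Finset.sum_congr rfl fun i hi => ?_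
        have hi := Finset.mem_range.1 hi
        rw [hI1 _ _ hi.le, hI2 _ _ hi.le, show p + q + 1 - i = (p + q - i) + 1 by omega,
          hh (p + q - i) (p - i) (by omega)]
        have e1 : ¬ (p - i = 0) := by omega
        have e2 : (p - i = p + q - i) ↔ p = p + q := by omega
        have e3 : i + (p - i - 1) = p - 1 := by omega
        have e4 : i + (p - i) = p := by omega
        have e5 : p - i - 1 = p - 1 - i := by omega
        simp only [e1, if_false, e2, e3, e4]
        rw [e5]
      · rw [hI1 _ _ le_rfl, hI2 _ _ le_rfl, show p + q + 1 - p = q + 1 by omega,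
          show p - p = 0 by omega, hh q 0 (by omega)]
        have e2 : (0 = q) ↔ p = p + q := by omega
        have e3 : p + q - p = q := by omega
        simp only [e2, e3, if_true, add_zero]
    · refine Finset.sum_congr rfl fun x hx => ?_
      rw [hI3, show p + 1 + x = (p + x) + 1 by omega, hf (p + x) p (by omega),
        show p + q + 1 - (p + x + 1) = q - x by omega]
      have e2 : (p = p + x) ↔ x = 0 := by omega
      simp only [e2]
  have hR1 : (if p = 0 then S * (f * h).app (p + q) z
        else (f * h).app (p + q) (Function.update z (p - 1) (rmul (z (p - 1)) S))) =
      (∑ i ∈ Finset.range p, f.app i z * h.app (p + q - i)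
        (Function.update (fun b => z (i + b)) (p - 1 - i) (rmul (z (p - 1)) S))) +
      (∑ x ∈ Finset.range (q + 1),
        (if p = 0 then S * f.app (p + x) z
            else f.app (p + x) (Function.update z (p - 1) (rmul (z (p - 1)) S))) *
          h.app (q - x) (fun b => z (p + x + b))) := by
    by_cases h0 : p = 0
    · subst h0
      simp [MultiSeq.app_mul, Finset.mul_sum, mul_assoc]
    · simp only [if_neg h0]
      rw [MultiSeq.app_mul, show p + q + 1 = p + (q + 1) by omega, Finset.sum_range_add]
      congr 1
      · refine Finset.sum_congr rfl fun i hi => ?_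
        have hi := Finset.mem_range.1 hi
        rw [hU1 _ _ _ (by omega), hU3 _ _ _ (by omega)]
      · refine Finset.sum_congr rfl fun x hx => ?_
        rw [hU2 _ _ _ (by omega), show p + q - (p + x) = q - x by omega]
  have hR2 : (if p = p + q then (f * h).app (p + q) z * S
        else (f * h).app (p + q) (Function.update z p (lmul S (z p)))) =
      (∑ i ∈ Finset.range (p + 1), f.app i z *
          (if p = p + q then h.app (p + q - i) (fun b => z (i + b)) * S
            else h.app (p + q - i)
              (Function.update (fun b => z (i + b)) (p - i) (lmul S (z p))))) +
      (∑ x ∈ Finset.range q, f.app (p + (x + 1)) (Function.update z p (lmul S (z p))) *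
          h.app (q - (x + 1)) (fun b => z (p + (x + 1) + b))) := by
    by_cases h0 : q = 0
    · subst h0
      simp [MultiSeq.app_mul, Finset.sum_mul, mul_assoc]
    · have h1 : ¬ (p = p + q) := by omega
      simp only [if_neg h1]
      rw [MultiSeq.app_mul, show p + q + 1 = (p + 1) + q by omega, Finset.sum_range_add]
      congr 1
      · refine Finset.sum_congr rfl fun i hi => ?_
        have hi := Finset.mem_range.1 hi
        rw [hU1 _ _ _ (by omega), hU3 _ _ _ (by omega)]
      · refine Finset.sum_congr rfl fun x hx => ?_
        rw [hU2 _ _ _ (by omega), show p + q - (p + 1 + x) = q - (x + 1) by omega,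
          show p + 1 + x = p + (x + 1) by omega]
  rw [hL, hR1, hR2, Finset.sum_range_succ (n := p)]
  simp only [sub_mul, mul_sub, Finset.sum_sub_distrib]
  rw [Finset.sum_range_succ' (fun x => (if x = 0 then f.app (p + x) z * S
    else f.app (p + x) (Function.update z p (lmul S (z p)))) *
      h.app (q - x) (fun b => z (p + x + b)))]
  simp only [Nat.add_eq_zero_iff, one_ne_zero, and_false, if_false, if_true, add_zero,
    Nat.sub_zero, mul_assoc]
  abel

theorem lac_add {Y : Point k g s}
    {f h : MultiSeq k (Point k g s) (Matrix (Fin s) (Fin s) k)} (hf : LAC Y f) (hh : LAC Y h) :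
    LAC Y (f + h) := by
  rw [lac_iff_app] at *
  intro n p hp S z
  simp only [MultiSeq.app_add, hf n p hp S z, hh n p hp S z]
  split_ifs <;> simp only [mul_add, add_mul, add_sub_add_comm]

theorem lac_algebraMap (Y : Point k g s) (c : k) :
    LAC Y (algebraMap k (MultiSeq k (Point k g s) (Matrix (Fin s) (Fin s) k)) c) := by
  rw [Algebra.algebraMap_eq_smul_one, lac_iff_app]
  intro n p hp S z
  rcases Nat.eq_zero_or_pos n with rfl | hn
  · obtain rfl : p = 0 := by omega
    simp [MultiSeq.app_smul, MultiSeq.app_one]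
  · have : n ≠ 0 := by omega
    simp [MultiSeq.app_smul, MultiSeq.app_one, this]

/-- The `k`-algebra of formal nc germs about `Y`: sequences of multilinear maps that satisfy
`LAC(Y)`, with termwise addition and the convolution product. -/
def formalGerms (Y : Point k g s) :
    Subalgebra k (MultiSeq k (Point k g s) (Matrix (Fin s) (Fin s) k)) where
  carrier := {f | LAC Y f}
  mul_mem' := LAC.mul
  add_mem' := lac_add
  algebraMap_mem' := lac_algebraMap Y

/-! ### The free algebra: vanishing ideals, differentials, completion -/

/-- The block matrix with `ℓ + 1` diagonal blocks `Y_j`, the blocks `Z^1_j, …, Z^ℓ_j` directly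
above the diagonal, and zero blocks elsewhere. -/
def blockBidiag (Y : Point k g s) {ℓ : ℕ} (Z : Fin ℓ → Point k g s) (j : Fin g) :
    Matrix (Fin (ℓ + 1)) (Fin (ℓ + 1)) (Matrix (Fin s) (Fin s) k) :=
  Matrix.of fun a b =>
    if a = b then Y j
    else if h : a.1 + 1 = b.1 then Z ⟨a, by omega⟩ j
    else 0

/-- Evaluation of nc polynomials at the `g`-tuple of block matrices `blockBidiag Y Z`. -/
noncomputable def blockEval (Y : Point k g s) {ℓ : ℕ} (Z : Fin ℓ → Point k g s) :
    FreeAlgebra k (Fin g) →ₐ[k]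
      Matrix (Fin (ℓ + 1)) (Fin (ℓ + 1)) (Matrix (Fin s) (Fin s) k) :=
  FreeAlgebra.lift k (blockBidiag Y Z)

/-- The `ℓ`-th nc differential `Δ^ℓ_Y p (Z^1, …, Z^ℓ)` of an nc polynomial `p`: the top right
block of `p` evaluated at `blockBidiag Y Z`. -/
noncomputable def ncDiff (Y : Point k g s) (p : FreeAlgebra k (Fin g)) (ℓ : ℕ)
    (Z : Fin ℓ → Point k g s) : Matrix (Fin s) (Fin s) k :=
  blockEval Y Z p 0 (Fin.last ℓ)

/-- The vanishing ideal `I(Y) = {p | p(Y) = 0}` in the free algebra. -/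
noncomputable def vanishingIdeal (Y : Point k g s) : Ideal (FreeAlgebra k (Fin g)) :=
  RingHom.ker (FreeAlgebra.lift k Y)

instance (Y : Point k g s) : (vanishingIdeal Y).IsTwoSided :=
  inferInstanceAs (RingHom.ker (FreeAlgebra.lift k Y)).IsTwoSided

/-- The ideal `I_ℓ(Y)` of all nc polynomials that vanish at the block matrices `blockBidiag Y Z`
for all `Z^1, …, Z^ℓ`. -/
noncomputable def higherVanishingIdeal (Y : Point k g s) (ℓ : ℕ) :
    Ideal (FreeAlgebra k (Fin g)) :=
  ⨅ Z : Fin ℓ → Point k g s, RingHom.ker (blockEval Y Z)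

/-- The inverse limit `lim_ℓ R / I^ℓ` of the quotients of a `k`-algebra `R` by the powers of a
two-sided ideal `I`, as the algebra of compatible families. -/
def powerCompletion {R : Type*} [Ring R] [Algebra k R] (I : Ideal R) [I.IsTwoSided] :
    Subalgebra k ((ℓ : ℕ) → R ⧸ I ^ ℓ) where
  carrier := {x | ∀ (m n : ℕ) (h : m ≤ n),
    Ideal.Quotient.factor (Ideal.pow_le_pow_right h) (x n) = x m}
  mul_mem' hx hy m n h := by simp only [Pi.mul_apply, map_mul, hx m n h, hy m n h]
  add_mem' hx hy m n h := by simp only [Pi.add_apply, map_add, hx m n h, hy m n h]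
  algebraMap_mem' _ _ _ _ := rfl

end Points

end FreeAnalysis

/-! The map `taylor`, sending p to (Δ^ℓ_Y p)_ℓ, is an algebra homomorphism, and evaluation at block
bidiagonal points only records its terms (`blockEval_eq`). Both claims thus compare the order of
vanishing of germs with the powers of I = I(Y).

Claim 1 needs no semisimplicity. Orders add under convolution, so elements of I^ℓ have germs of
order at least ℓ. Conversely, let τ be a linear section of evaluation at Y. The elements τ(m)x_j -
τ(mY_j), for m in the range of evaluation, lie in I. Telescoping along the letters of p expresses
τ(1)p - τ(p(Y)) through such elements, with Fox derivatives of p as right coefficients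
(`exists_fox_derivatives`). The same coefficients appear when the first argument of Δ^{n+1}p is
split off, so their germs vanish to one order less; induction puts them in a power of I, and p in
the next one (`mem_pow_of_taylor_eq_zero`).

Claim 2 uses that the centralizer C of a semisimple Y is a semisimple algebra, which in
characteristic 0 has a separability idempotent ∑ u_i ⊗ v_i. The average ∑ u_i X v_i commutes with C,
hence is a polynomial in Y by the density theorem. Averaging also gives a C-bimodule complement to
the tuples [S, Y]. If the terms of a germ below degree n vanish, its n-th term is C-balanced and
vanishes as soon as one argument is some [S, Y] (`LAC.isLeading`). Such a map is Δ^n q for some q in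
I^n: split off the first argument, realize the linear factors by `exists_taylor_one`, and induct
(`exists_taylor_eq_of_isLeading`). Correcting one degree at a time, every germ agrees with a
polynomial to any given order (`exists_taylor_eq`); by claim 1 this polynomial is unique modulo I^ℓ.
-/

namespace FreeAnalysis

/-! ### Separability idempotents of semisimple algebras in characteristic zero -/

section Separability

open TensorProduct

variable {k : Type*} [Field k]

variable (k) in
/-- The bilinear form `(x, y) ↦ tr (z ↦ x y z)` of a `k`-algebra. -/
noncomputable def regularTraceForm (C : Type*) [Ring C] [Algebra k C] : LinearMap.BilinForm k C :=
  (LinearMap.mul k C).compr₂ ((LinearMap.trace k C).comp (Algebra.lmul k C).toLinearMap)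

variable {C : Type*} [Ring C] [Algebra k C]

theorem regularTraceForm_apply (x y : C) :
    regularTraceForm k C x y = LinearMap.trace k C (LinearMap.mulLeft k (x * y)) := rfl

theorem regularTraceForm_mul_left (x y z : C) :
    regularTraceForm k C (x * y) z = regularTraceForm k C x (y * z) := by
  simp only [regularTraceForm_apply, mul_assoc]

theorem regularTraceForm_comm (x y : C) :
    regularTraceForm k C x y = regularTraceForm k C y x := by
  simp only [regularTraceForm_apply, LinearMap.mulLeft_mul]
  exact LinearMap.trace_mul_comm k _ _

/-- The radical of the form is an ideal, so by semisimplicity it is generated by an idempotent e.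
Left multiplication by e is a projection of trace 0; in characteristic 0 the trace is the rank, so e
= 0. -/
theorem regularTraceForm_nondegenerate [CharZero k] [FiniteDimensional k C] [IsSemisimpleRing C] :
    (regularTraceForm k C).Nondegenerate := by
  have key : ∀ a : C, (∀ b, regularTraceForm k C a b = 0) → a = 0 := by
    intro a ha
    let N : Ideal C :=
      { carrier := {x | ∀ b, regularTraceForm k C x b = 0}
        add_mem' := fun hx hy b => by rw [map_add, LinearMap.add_apply, hx b, hy b, add_zero]
        zero_mem' := fun b => by rw [map_zero, LinearMap.zero_apply]
        smul_mem' := fun c x hx b => by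
          rw [smul_eq_mul, regularTraceForm_mul_left, regularTraceForm_comm,
            regularTraceForm_mul_left]
          exact hx _ }
    obtain ⟨e, he, hN⟩ := IsSemisimpleRing.ideal_eq_span_idempotent N
    have heN : e ∈ N := hN ▸ Ideal.subset_span rfl
    have htr : LinearMap.trace k C (LinearMap.mulLeft k e) = 0 := by
      have := heN 1
      rwa [regularTraceForm_apply, mul_one] at this
    have hidem : IsIdempotentElem (LinearMap.mulLeft k e) := by
      rw [IsIdempotentElem, Module.End.mul_eq_comp, ← LinearMap.mulLeft_mul, he.eq]
    have h0 := (LinearMap.IsIdempotentElem.trace_eq_zero_iff hidem).1 htr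
    have he0 : e = 0 := by simpa using LinearMap.congr_fun h0 1
    have haN : a ∈ N := ha
    rw [hN, he0] at haN
    simpa using haN
  exact ⟨key, fun a ha => key a fun b => (regularTraceForm_comm a b).trans (ha b)⟩

/-- A finite-dimensional semisimple algebra over a field of characteristic zero has a
separability idempotent. -/
theorem exists_separability_idempotent (k C : Type*) [Field k] [CharZero k] [Ring C] [Algebra k C]
    [FiniteDimensional k C] [IsSemisimpleRing C] :
    ∃ (n : ℕ) (u v : Fin n → C), ∑ i, u i * v i = 1 ∧
      ∀ c, ∑ i, (c * u i) ⊗ₜ[k] v i = ∑ i, u i ⊗ₜ[k] (v i * c) := by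
  set B := regularTraceForm k C with hBdef
  have hB : B.Nondegenerate := regularTraceForm_nondegenerate
  let b := Module.finBasis k C
  let d := B.dualBasis hB b
  have hrepr : ∀ y i, b.repr y i = B (d i) y := by
    intro y i
    conv_rhs => rw [← b.sum_repr y, map_sum]
    simp only [d, map_smul, LinearMap.BilinForm.apply_dualBasis_left, smul_eq_mul, mul_ite,
      mul_one, mul_zero, Finset.sum_ite_eq', Finset.mem_univ, if_true]
  have hb : ∀ y, y = ∑ i, B (d i) y • b i := by
    intro y
    conv_lhs => rw [← b.sum_repr y]
    simp only [hrepr]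
  have hd : ∀ y, y = ∑ i, B y (b i) • d i := by
    intro y
    conv_lhs => rw [← d.sum_repr y]
    simp only [d, LinearMap.BilinForm.dualBasis_repr_apply]
  -- The idempotent is ∑ b_i ⊗ d_i for a basis b and its dual basis d under the trace form.
  refine ⟨_, b, d, ?_, fun c => ?_⟩
  -- The numbers B(x b_i, d_i) are the diagonal entries of left multiplication by x in the basis b;
  -- nondegeneracy then gives ∑ b_i d_i = 1.
  · have : ∀ x, B x (∑ i, b i * d i) = B x 1 := by
      intro x
      have h1 : B x 1 = LinearMap.trace k C (LinearMap.mulLeft k x) := by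
        rw [hBdef, regularTraceForm_apply, mul_one]
      rw [h1, LinearMap.trace_eq_matrix_trace k b, Matrix.trace, map_sum]
      refine Finset.sum_congr rfl fun i _ => ?_
      rw [Matrix.diag_apply, LinearMap.toMatrix_apply, hrepr, LinearMap.mulLeft_apply, hBdef,
        regularTraceForm_comm (k := k) (d i), regularTraceForm_mul_left]
    refine sub_eq_zero.1 (hB.1 _ fun x => ?_)
    rw [hBdef, regularTraceForm_comm, ← hBdef, map_sub, this, sub_self]
  -- Expand c b_i in the basis b and move the scalars across the tensor sign; summed over i, they
  -- are the coordinates of d_j c in the basis d.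
  · have h1 : ∀ i, (c * b i) ⊗ₜ[k] d i = ∑ j, b j ⊗ₜ[k] (B (d j * c) (b i) • d i) := by
      intro i
      conv_lhs => rw [hb (c * b i)]
      rw [TensorProduct.sum_tmul]
      refine Finset.sum_congr rfl fun j _ => ?_
      rw [TensorProduct.smul_tmul, hBdef, regularTraceForm_mul_left]
    simp only [h1]
    rw [Finset.sum_comm]
    refine Finset.sum_congr rfl fun j _ => ?_
    rw [← TensorProduct.tmul_sum, ← hd]

end Separability

/-! ### Averaging onto the algebra generated by a semisimple point -/

section Averaging

variable {k : Type*} [Field k] {g s : ℕ}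

/-- A separability idempotent `∑ u_i ⊗ v_i` of the centralizer of `Y` such that averaging over it
projects matrices to the algebra generated by `Y`. -/
structure AveragingFamily (Y : Point k g s) where
  n : ℕ
  u : Fin n → Matrix (Fin s) (Fin s) k
  v : Fin n → Matrix (Fin s) (Fin s) k
  u_comm : ∀ i j, u i * Y j = Y j * u i
  v_comm : ∀ i j, v i * Y j = Y j * v i
  sum_mul : ∑ i, u i * v i = 1
  balanced : ∀ c, (∀ j, c * Y j = Y j * c) →
    ∀ X, ∑ i, c * u i * X * v i = ∑ i, u i * X * (v i * c)
  mean_mem : ∀ X, ∃ p, FreeAlgebra.lift k Y p = ∑ i, u i * X * v i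

/-- The endomorphism ring of a finitely generated semisimple module is semisimple, so the
centralizer has a separability idempotent. Averages lie in the double centralizer, which is the
algebra generated by Y by Jacobson density. -/
theorem IsSemisimplePoint.nonempty_averagingFamily [CharZero k] {Y : Point k g s}
    (hY : IsSemisimplePoint Y) : Nonempty (AveragingFamily Y) := by
  let W := Fin s → k
  let T : Matrix (Fin s) (Fin s) k ≃ₐ[k] Module.End k W := Matrix.toLinAlgEquiv'
  let ρ : FreeAlgebra k (Fin g) →ₐ[k] Module.End k W := T.toAlgHom.comp (FreeAlgebra.lift k Y)
  let A : Subalgebra k (Module.End k W) := ρ.range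
  have hTapp : ∀ (m : Matrix (Fin s) (Fin s) k) (w : W), T m w = m.mulVec w := fun _ _ => rfl
  have hρι : ∀ j, ρ (FreeAlgebra.ι k j) = T (Y j) := by intro j; simp [ρ]
  have hss : IsSemisimpleModule A W := by
    refine { exists_isCompl := fun N => ?_ }
    obtain ⟨W', hW', hc⟩ := hY (N.restrictScalars k) (fun j w hw =>
      N.smul_mem ⟨ρ (FreeAlgebra.ι k j), ⟨_, rfl⟩⟩ hw |> fun h => by
        change (ρ (FreeAlgebra.ι k j)) w ∈ N at h
        rwa [hρι] at h)
    have hstab : ∀ p : FreeAlgebra k (Fin g), ∀ w ∈ W', ρ p w ∈ W' := by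
      intro p
      induction p using FreeAlgebra.induction with
      | grade0 r => intro w hw; rw [AlgHom.commutes]; exact W'.smul_mem r hw
      | grade1 j => intro w hw; rw [hρι]; exact hW' j w hw
      | mul a b ha hb => intro w hw; rw [map_mul]; exact ha _ (hb w hw)
      | add a b ha hb => intro w hw; rw [map_add]; exact W'.add_mem (ha w hw) (hb w hw)
    let N' : Submodule A W :=
      { W'.toAddSubmonoid with
        smul_mem' := by
          rintro ⟨_, p, rfl⟩ w hw
          exact hstab p w hw }
    refine ⟨N', ?_⟩
    rw [isCompl_iff, disjoint_iff, codisjoint_iff] at hc ⊢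
    refine ⟨?_, ?_⟩
    · rw [eq_bot_iff]
      intro x hx
      have : x ∈ N.restrictScalars k ⊓ W' := hx
      rw [hc.1] at this
      simpa using this
    · rw [eq_top_iff]
      intro x _
      have : x ∈ N.restrictScalars k ⊔ W' := by rw [hc.2]; trivial
      obtain ⟨y, hy, z, hz, rfl⟩ := Submodule.mem_sup.1 this
      exact Submodule.add_mem_sup (show y ∈ N from hy) (show z ∈ N' from hz)
  have : Module.Finite A W := Module.Finite.of_restrictScalars_finite k A W
  have : IsSemisimpleRing (Module.End A W) := IsSemisimpleRing.moduleEnd A W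
  let φ : Module.End A W →ₗ[k] Module.End k W :=
    { toFun := fun c => c.restrictScalars k
      map_add' := fun _ _ => rfl
      map_smul' := fun _ _ => rfl }
  have hφinj : Function.Injective φ := fun a b h =>
    LinearMap.ext fun w => LinearMap.congr_fun h w
  have : FiniteDimensional k (Module.End A W) := FiniteDimensional.of_injective φ hφinj
  obtain ⟨n, u, v, huv, hsep⟩ := exists_separability_idempotent k (Module.End A W)
  let ψ : Module.End A W →ₗ[k] Matrix (Fin s) (Fin s) k := T.symm.toLinearMap ∘ₗ φ
  have hψmul : ∀ a b, ψ (a * b) = ψ a * ψ b := fun a b => map_mul T.symm (φ a) (φ b)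
  have hψone : ψ 1 = 1 := map_one T.symm
  have hTψ : ∀ c, T (ψ c) = φ c := fun c => T.apply_symm_apply _
  have hψY : ∀ c j, ψ c * Y j = Y j * ψ c := by
    intro c j
    apply T.injective
    rw [map_mul, map_mul, hTψ, ← hρι]
    refine LinearMap.ext fun w => ?_
    exact c.map_smul (⟨ρ (FreeAlgebra.ι k j), ⟨_, rfl⟩⟩ : A) w
  have hψsurj : ∀ c : Matrix (Fin s) (Fin s) k, (∀ j, c * Y j = Y j * c) → ∃ c', ψ c' = c := by
    intro c hc
    have hcomm : ∀ p, T c * ρ p = ρ p * T c := by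
      intro p
      induction p using FreeAlgebra.induction with
      | grade0 r => rw [AlgHom.commutes]; exact (Algebra.commutes r _).symm
      | grade1 j => rw [hρι, ← map_mul, ← map_mul, hc]
      | mul a b ha hb => rw [map_mul, ← mul_assoc, ha, mul_assoc, hb, mul_assoc]
      | add a b ha hb => rw [map_add, mul_add, add_mul, ha, hb]
    refine ⟨{ toFun := T c, map_add' := map_add _, map_smul' := ?_ }, ?_⟩
    · rintro ⟨_, p, rfl⟩ w
      exact LinearMap.congr_fun (hcomm p) w
    · apply T.injective
      rw [hTψ]
      rfl
  have hbal : ∀ c, (∀ j, c * Y j = Y j * c) →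
      ∀ X, ∑ i, c * ψ (u i) * X * ψ (v i) = ∑ i, ψ (u i) * X * (ψ (v i) * c) := by
    intro c hc X
    obtain ⟨c, rfl⟩ := hψsurj c hc
    -- Applying a ⊗ b ↦ a X b to the tensor identity turns it into an identity of matrices.
    let G : TensorProduct k (Module.End A W) (Module.End A W) →ₗ[k] Matrix (Fin s) (Fin s) k :=
      TensorProduct.lift (((LinearMap.mul k (Matrix (Fin s) (Fin s) k)).comp
        (LinearMap.mulRight k X ∘ₗ ψ)).compl₂ ψ)
    have hG : ∀ a b, G (a ⊗ₜ[k] b) = ψ a * X * ψ b := fun a b => rfl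
    have := congrArg G (hsep c)
    simpa only [map_sum, hG, hψmul] using this
  refine ⟨⟨n, fun i => ψ (u i), fun i => ψ (v i), fun i j => hψY _ j, fun i j => hψY _ j, ?_,
    hbal, fun X => ?_⟩⟩
  · simp only [← hψmul, ← map_sum, huv, hψone]
  · set m := ∑ i, ψ (u i) * X * ψ (v i) with hm
    have hmc : ∀ c : Module.End A W, ψ c * m = m * ψ c := by
      intro c
      have := hbal (ψ c) (hψY c) X
      simpa only [hm, Finset.mul_sum, Finset.sum_mul, mul_assoc] using this
    let F : Module.End (Module.End A W) W :=
      { toFun := T m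
        map_add' := map_add _
        map_smul' := fun c w => by
          have h := congrArg T (hmc c)
          rw [map_mul, map_mul, hTψ] at h
          exact (LinearMap.congr_fun h w).symm }
    classical
    -- Density gives agreement on finite sets only; the standard basis is enough to identify the
    -- matrices.
    obtain ⟨⟨_, p, rfl⟩, hp⟩ := jacobson_density (R := A) (M := W) F
      (Finset.univ.image fun i : Fin s => (Pi.single i 1 : W))
    refine ⟨p, T.injective ?_⟩
    refine (Pi.basisFun k (Fin s)).ext fun i => ?_
    rw [Pi.basisFun_apply]
    exact (hp _ (Finset.mem_image_of_mem _ (Finset.mem_univ i))).symm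

end Averaging

/-! ### The germ of an nc polynomial -/

section Taylor

variable {k : Type*} [Field k] {g s : ℕ}

section

variable {V : Type*}

@[simp]
theorem ins_zero_zero (v : V) (z : ℕ → V) : ins 0 v z 0 = v := by simp [ins]

@[simp]
theorem ins_zero_succ (v : V) (z : ℕ → V) (i : ℕ) : ins 0 v z (i + 1) = z i := by simp [ins]

theorem update_succ_ins_zero (p : ℕ) (v w : V) (z : ℕ → V) :
    Function.update (ins 0 w z) (p + 1) v = ins 0 w (Function.update z p v) := by
  funext i
  rcases i with _ | i <;> simp [Function.update_apply]

theorem update_zero_ins_zero (v w : V) (z : ℕ → V) :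
    Function.update (ins 0 w z) 0 v = ins 0 v z := by
  funext i
  rcases i with _ | i <;> simp

theorem ins_zero_self (z : ℕ → V) : ins 0 (z 0) (fun i => z (i + 1)) = z := by
  funext i
  rcases i with _ | i <;> simp

end

theorem MultiSeq.app_congr {V A : Type*} [AddCommGroup V] [Module k V] [Ring A] [Algebra k A]
    (f : MultiSeq k V A) {n : ℕ} {z z' : ℕ → V} (h : ∀ i < n, z i = z' i) :
    f.app n z = f.app n z' := by
  unfold MultiSeq.app
  congr 1
  funext i
  exact h i i.2

/-- The germ of the `j`-th coordinate. -/
def coordSeq (Y : Point k g s) (j : Fin g) :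
    MultiSeq k (Point k g s) (Matrix (Fin s) (Fin s) k) := fun ℓ =>
  match ℓ with
  | 0 => MultilinearMap.constOfIsEmpty k _ (Y j)
  | 1 => (LinearMap.proj j : Point k g s →ₗ[k] Matrix (Fin s) (Fin s) k).compMultilinearMap
      (MultilinearMap.ofSubsingleton k _ _ (0 : Fin 1) LinearMap.id)
  | _ + 2 => 0

theorem app_coordSeq_zero (Y : Point k g s) (j : Fin g) (z : ℕ → Point k g s) :
    (coordSeq Y j).app 0 z = Y j := rfl

theorem app_coordSeq_one (Y : Point k g s) (j : Fin g) (z : ℕ → Point k g s) :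
    (coordSeq Y j).app 1 z = z 0 j := rfl

theorem app_coordSeq_add_two (Y : Point k g s) (j : Fin g) (n : ℕ) (z : ℕ → Point k g s) :
    (coordSeq Y j).app (n + 2) z = 0 := rfl

theorem lac_coordSeq (Y : Point k g s) (j : Fin g) : LAC Y (coordSeq Y j) := by
  rw [lac_iff_app]
  intro n p hp S z
  rcases n with _ | _ | n
  · obtain rfl : p = 0 := by omega
    simp [app_coordSeq_zero, app_coordSeq_one, comm]
  · rw [app_coordSeq_add_two]
    have : p = 0 ∨ p = 1 := by omega
    rcases this with rfl | rfl <;> simp [app_coordSeq_one, lmul, rmul]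
  · rw [app_coordSeq_add_two]
    simp [app_coordSeq_add_two]

/-- The germ `(Δ^ℓ_Y p)_ℓ` of an nc polynomial `p`. -/
noncomputable def taylor (Y : Point k g s) :
    FreeAlgebra k (Fin g) →ₐ[k] MultiSeq k (Point k g s) (Matrix (Fin s) (Fin s) k) :=
  FreeAlgebra.lift k (coordSeq Y)

theorem taylor_ι (Y : Point k g s) (j : Fin g) :
    taylor Y (FreeAlgebra.ι k j) = coordSeq Y j := FreeAlgebra.lift_ι_apply _ _

theorem taylor_mem (Y : Point k g s) (p : FreeAlgebra k (Fin g)) : taylor Y p ∈ formalGerms Y := by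
  induction p using FreeAlgebra.induction with
  | grade0 r => rw [AlgHom.commutes]; exact (formalGerms Y).algebraMap_mem r
  | grade1 j => rw [taylor_ι]; exact lac_coordSeq Y j
  | mul a b ha hb => rw [map_mul]; exact (formalGerms Y).mul_mem ha hb
  | add a b ha hb => rw [map_add]; exact (formalGerms Y).add_mem ha hb

/-- The block upper triangular matrix with the blocks `f_{b-a} (z_a, …, z_{b-1})`. -/
def blockToeplitz (n : ℕ) (z : ℕ → Point k g s) :
    MultiSeq k (Point k g s) (Matrix (Fin s) (Fin s) k) →ₐ[k]
      Matrix (Fin (n + 1)) (Fin (n + 1)) (Matrix (Fin s) (Fin s) k) :=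
  AlgHom.ofLinearMap
    { toFun := fun f => Matrix.of fun a b =>
        if a ≤ b then f.app (b - a) (fun i => z (a + i)) else 0
      map_add' := fun f h => by
        ext1 a b
        simp only [Matrix.of_apply, Matrix.add_apply, MultiSeq.app_add]
        split_ifs <;> simp
      map_smul' := fun c f => by
        ext1 a b
        simp only [Matrix.of_apply, Matrix.smul_apply, MultiSeq.app_smul, RingHom.id_apply]
        split_ifs <;> simp }
    (by
      ext1 a b
      change (if a ≤ b then _ else _) = _
      rw [MultiSeq.app_one, Matrix.one_apply]
      by_cases h : a = b
      · simp [h]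
      · by_cases h' : a ≤ b
        · have : b.1 - a.1 ≠ 0 := by
            have := Fin.lt_def.1 (lt_of_le_of_ne h' h)
            omega
          simp [h, this]
        · simp [h, h'])
    (fun f h => by
      ext1 a b
      change (if a ≤ b then _ else _) = _
      rw [Matrix.mul_apply]
      change _ = ∑ c : Fin (n + 1), (if a ≤ c then f.app (c - a) (fun i => z (a + i)) else 0) *
        (if c ≤ b then h.app (b - c) (fun i => z (c + i)) else 0)
      simp only [Fin.le_def]
      rw [Fin.sum_univ_eq_sum_range (fun c =>
        (if a.1 ≤ c then f.app (c - a) (fun i => z (a + i)) else 0) *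
          (if c ≤ b.1 then h.app (b - c) (fun i => z (c + i)) else 0)) (n + 1)]
      have hb := b.2
      generalize a.1 = a, b.1 = b at hb ⊢
      by_cases hab : a ≤ b
      · obtain ⟨d, hd⟩ := Nat.exists_eq_add_of_le hab
        -- By triangularity only the intermediate indices from a to b contribute, and these give the
        -- convolution.
        have hn : n + 1 = a + (d + 1) + (n - b) := by omega
        rw [if_pos hab, hn, Finset.sum_range_add, Finset.sum_range_add, MultiSeq.app_mul,
          show b - a = d by omega]
        rw [Finset.sum_eq_zero (s := Finset.range a), Finset.sum_eq_zero (s := Finset.range (n - b)),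
          zero_add, add_zero]
        · refine Finset.sum_congr rfl fun i hi => ?_
          have := Finset.mem_range.1 hi
          rw [if_pos (by omega), if_pos (by omega), show a + i - a = i by omega,
            show b - (a + i) = d - i by omega]
          simp only [add_assoc]
        · intro i hi
          rw [if_neg (by omega : ¬ (a + (d + 1) + i ≤ b)), mul_zero]
        · intro i hi
          have := Finset.mem_range.1 hi
          rw [if_neg (by omega), zero_mul]
      · rw [if_neg hab, Finset.sum_eq_zero]
        intro i hi
        by_cases h1 : a ≤ i
        · rw [if_neg (by omega : ¬ (i ≤ b)), mul_zero]
        · rw [if_neg h1, zero_mul])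

theorem blockToeplitz_apply (n : ℕ) (z : ℕ → Point k g s)
    (f : MultiSeq k (Point k g s) (Matrix (Fin s) (Fin s) k)) (a b : Fin (n + 1)) :
    blockToeplitz n z f a b = if a ≤ b then f.app (b - a) (fun i => z (a + i)) else 0 := rfl

/-- Algebra homomorphisms out of the free algebra are determined on the generators, and the block
Toeplitz matrix of a coordinate germ is block bidiagonal. -/
theorem blockEval_eq (Y : Point k g s) (n : ℕ) (z : ℕ → Point k g s) :
    blockEval Y (fun i : Fin n => z i) = (blockToeplitz n z).comp (taylor Y) := by
  refine FreeAlgebra.hom_ext (funext fun j => ?_)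
  simp only [Function.comp_apply, blockEval, FreeAlgebra.lift_ι_apply, AlgHom.comp_apply, taylor_ι]
  ext1 a b
  rw [blockToeplitz_apply]
  simp only [blockBidiag, Matrix.of_apply]
  by_cases h : a = b
  · subst h
    simp [app_coordSeq_zero]
  · by_cases h' : a ≤ b
    · have hlt := Fin.lt_def.1 (lt_of_le_of_ne h' h)
      by_cases h1 : a.1 + 1 = b.1
      · rw [if_neg h, dif_pos h1, if_pos h', show b.1 - a.1 = 1 by omega, app_coordSeq_one]
        rfl
      · obtain ⟨m, hm⟩ := Nat.exists_eq_add_of_le (show 2 ≤ b.1 - a.1 by omega)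
        rw [if_neg h, dif_neg h1, if_pos h', hm, add_comm, app_coordSeq_add_two]
    · rw [if_neg h, if_neg h', dif_neg]
      rw [Fin.le_def] at h'
      omega

theorem ncDiff_eq (Y : Point k g s) (p : FreeAlgebra k (Fin g)) (n : ℕ) (z : ℕ → Point k g s) :
    ncDiff Y p n (fun i => z i) = (taylor Y p).app n z := by
  rw [ncDiff, blockEval_eq, AlgHom.comp_apply, blockToeplitz_apply]
  simp

theorem exists_seq {V : Type*} [Zero V] {n : ℕ} (Z : Fin n → V) :
    ∃ z : ℕ → V, Z = fun i : Fin n => z i :=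
  ⟨fun i => if hi : i < n then Z ⟨i, hi⟩ else 0, by funext i; simp⟩

/-- Block (a, b) with a ≤ b is the term of degree b - a at consecutive arguments, and the first row
already contains all degrees up to ℓ. -/
theorem mem_higherVanishingIdeal_iff (Y : Point k g s) (ℓ : ℕ) (p : FreeAlgebra k (Fin g)) :
    p ∈ higherVanishingIdeal Y ℓ ↔ ∀ m ≤ ℓ, ∀ z, (taylor Y p).app m z = 0 := by
  simp only [higherVanishingIdeal, Submodule.mem_iInf, RingHom.mem_ker]
  constructor
  · intro h m hm z
    have := congrFun (congrFun (h fun i => z i) 0) (⟨m, by omega⟩ : Fin (ℓ + 1))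
    change blockEval Y (fun i : Fin ℓ => z i) p 0 _ = 0 at this
    rw [blockEval_eq, AlgHom.comp_apply, blockToeplitz_apply, if_pos (Fin.zero_le _)] at this
    simpa using this
  · intro h Z
    obtain ⟨z, rfl⟩ := exists_seq Z
    change blockEval Y (fun i : Fin ℓ => z i) p = 0
    rw [blockEval_eq]
    ext1 a b
    rw [AlgHom.comp_apply, blockToeplitz_apply, h _ (by omega)]
    simp

theorem taylor_app_zero (Y : Point k g s) (p : FreeAlgebra k (Fin g)) (z : ℕ → Point k g s) :
    (taylor Y p).app 0 z = FreeAlgebra.lift k Y p := by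
  induction p using FreeAlgebra.induction with
  | grade0 r =>
    rw [AlgHom.commutes, AlgHom.commutes, Algebra.algebraMap_eq_smul_one, MultiSeq.app_smul,
      MultiSeq.app_one, if_pos rfl, Algebra.algebraMap_eq_smul_one]
  | grade1 j => rw [taylor_ι, FreeAlgebra.lift_ι_apply, app_coordSeq_zero]
  | mul a b ha hb => simp [map_mul, MultiSeq.app_mul, ha, hb]
  | add a b ha hb => simp [map_add, MultiSeq.app_add, ha, hb]

theorem mem_vanishingIdeal_iff (Y : Point k g s) (p : FreeAlgebra k (Fin g)) :
    p ∈ vanishingIdeal Y ↔ FreeAlgebra.lift k Y p = 0 := Iff.rfl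

/-- The product of series of orders at least `a` and `b` has order at least `a + b`, and its term
of degree `a + b` is the product of the leading terms. -/
theorem MultiSeq.app_mul_of_order {V A : Type*} [AddCommGroup V] [Module k V] [Ring A]
    [Algebra k A] {f h : MultiSeq k V A} {a b : ℕ} (hf : ∀ m < a, ∀ z, f.app m z = 0)
    (hh : ∀ m < b, ∀ z, h.app m z = 0) (m : ℕ) (hm : m ≤ a + b) (z : ℕ → V) :
    (f * h).app m z = if m = a + b then f.app a z * h.app b (fun i => z (a + i)) else 0 := by
  rw [MultiSeq.app_mul]
  split_ifs with hab
  · subst hab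
    rw [Finset.sum_eq_single a]
    · rw [Nat.add_sub_cancel_left]
    · intro i hi hia
      have := Finset.mem_range.1 hi
      rcases lt_or_gt_of_ne hia with h1 | h1
      · rw [hf i h1, zero_mul]
      · rw [hh _ (by omega), mul_zero]
    · intro h1
      exact absurd (Finset.mem_range.2 (by omega)) h1
  · refine Finset.sum_eq_zero fun i hi => ?_
    have := Finset.mem_range.1 hi
    rcases lt_or_ge i a with h1 | h1
    · rw [hf i h1, zero_mul]
    · rw [hh _ (by omega), mul_zero]

/-- Elements of the vanishing ideal have zero constant term, that is, order at least 1, and orders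
add. -/
theorem taylor_app_eq_zero_of_mem_pow (Y : Point k g s) :
    ∀ (ℓ : ℕ) (p : FreeAlgebra k (Fin g)), p ∈ vanishingIdeal Y ^ ℓ →
      ∀ m < ℓ, ∀ z, (taylor Y p).app m z = 0 := by
  intro ℓ
  induction ℓ with
  | zero => intro p _ m hm; omega
  | succ ℓ ih =>
    intro p hp
    rw [Submodule.pow_succ] at hp
    induction hp using Submodule.mul_induction_on' with
    | mem_mul_mem x hx y hy =>
      intro m hm z
      rw [map_mul, MultiSeq.app_mul_of_order (b := 1) (ih x hx) ?_ m (by omega), if_neg (by omega)]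
      intro i hi z
      obtain rfl : i = 0 := by omega
      rw [taylor_app_zero]
      exact hy
    | add x _ y _ hx hy =>
      intro m hm z
      rw [map_add, MultiSeq.app_add, hx m hm, hy m hm, add_zero]

end Taylor

/-! ### Polynomials whose differentials vanish up to a given order -/

section Vanishing

variable {k : Type*} [Field k] {g s : ℕ}

/-- Evaluation at `Y` has a linear section over its range. -/
theorem exists_evaluation_section (Y : Point k g s) :
    ∃ τ : Matrix (Fin s) (Fin s) k →ₗ[k] FreeAlgebra k (Fin g),
      ∀ p, FreeAlgebra.lift k Y (τ (FreeAlgebra.lift k Y p)) = FreeAlgebra.lift k Y p := by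
  set ρ := (FreeAlgebra.lift k Y).toLinearMap with hρ
  -- A right inverse on the range is extended arbitrarily to all matrices; outside the range τ is
  -- not a section.
  obtain ⟨σ, hσ⟩ := ρ.rangeRestrict.exists_rightInverse_of_surjective ρ.range_rangeRestrict
  obtain ⟨τ, hτ⟩ := σ.exists_extend
  refine ⟨τ, fun p => ?_⟩
  have h1 : τ (ρ p) = σ ⟨ρ p, ⟨p, rfl⟩⟩ := LinearMap.congr_fun hτ ⟨ρ p, ⟨p, rfl⟩⟩
  change ρ (τ (ρ p)) = ρ p
  rw [h1]
  exact congrArg Subtype.val (LinearMap.congr_fun hσ ⟨ρ p, ⟨p, rfl⟩⟩)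

/-- The defect of right multiplication by `x_j` for a linear section `τ` of the evaluation. -/
noncomputable def sectionDefect (Y : Point k g s)
    (τ : Matrix (Fin s) (Fin s) k →ₗ[k] FreeAlgebra k (Fin g)) (j : Fin g) :
    Matrix (Fin s) (Fin s) k →ₗ[k] FreeAlgebra k (Fin g) :=
  LinearMap.mulRight k (FreeAlgebra.ι k j) ∘ₗ τ -
    τ ∘ₗ LinearMap.mulRight k (Y j) ∘ₗ (FreeAlgebra.lift k Y).toLinearMap ∘ₗ τ

theorem sectionDefect_apply (Y : Point k g s)
    (τ : Matrix (Fin s) (Fin s) k →ₗ[k] FreeAlgebra k (Fin g)) (j : Fin g)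
    (m : Matrix (Fin s) (Fin s) k) :
    sectionDefect Y τ j m =
      τ m * FreeAlgebra.ι k j - τ (FreeAlgebra.lift k Y (τ m) * Y j) := rfl

variable {Y : Point k g s} {τ : Matrix (Fin s) (Fin s) k →ₗ[k] FreeAlgebra k (Fin g)}

/-- Since the subtracted term contains the evaluation of τ m instead of m, this holds for all m,
even outside the range of evaluation. That is needed because matrix units are inserted later. -/
theorem sectionDefect_mem
    (hτ : ∀ p, FreeAlgebra.lift k Y (τ (FreeAlgebra.lift k Y p)) = FreeAlgebra.lift k Y p)
    (j : Fin g) (m : Matrix (Fin s) (Fin s) k) : sectionDefect Y τ j m ∈ vanishingIdeal Y := by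
  rw [mem_vanishingIdeal_iff, sectionDefect_apply, map_sub, map_mul, FreeAlgebra.lift_ι_apply]
  have := hτ (τ m * FreeAlgebra.ι k j)
  rw [map_mul, FreeAlgebra.lift_ι_apply] at this
  rw [this, sub_self]

theorem section_eval_mul_ι
    (hτ : ∀ p, FreeAlgebra.lift k Y (τ (FreeAlgebra.lift k Y p)) = FreeAlgebra.lift k Y p)
    (j : Fin g) (q : FreeAlgebra k (Fin g)) :
    sectionDefect Y τ j (FreeAlgebra.lift k Y q) =
      τ (FreeAlgebra.lift k Y q) * FreeAlgebra.ι k j -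
        τ (FreeAlgebra.lift k Y (q * FreeAlgebra.ι k j)) := by
  rw [sectionDefect_apply, hτ, map_mul (FreeAlgebra.lift k Y), FreeAlgebra.lift_ι_apply]

/-- The Leibniz rule for splitting off the first argument: v goes to h exactly when f contributes
its constant term. -/
theorem MultiSeq.app_mul_succ {V A : Type*} [AddCommGroup V] [Module k V] [Ring A] [Algebra k A]
    (f h : MultiSeq k V A) (n : ℕ) (v : V) (z : ℕ → V) :
    (f * h).app (n + 1) (ins 0 v z) = f.app 0 z * h.app (n + 1) (ins 0 v z) +
      ∑ i ∈ Finset.range (n + 1),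
        f.app (i + 1) (ins 0 v z) * h.app (n - i) (fun b => z (i + b)) := by
  rw [MultiSeq.app_mul, Finset.sum_range_succ', add_comm]
  congr 1
  · simp only [zero_add, Nat.sub_zero]
    congr 1
    exact f.app_congr fun i hi => absurd hi (Nat.not_lt_zero i)
  · refine Finset.sum_congr rfl fun i _ => ?_
    rw [Nat.add_sub_add_right]
    congr 2
    funext b
    rw [show i + 1 + b = i + b + 1 by omega, ins_zero_succ]

theorem sum_comm_three {ι ι₁ ι₂ ι₃ N : Type*} [AddCommMonoid N] (S : Finset ι) [Fintype ι₁]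
    [Fintype ι₂] [Fintype ι₃] (F : ι → ι₁ → ι₂ → ι₃ → N) :
    ∑ i ∈ S, ∑ a, ∑ b, ∑ c, F i a b c = ∑ a, ∑ b, ∑ c, ∑ i ∈ S, F i a b c := by
  rw [Finset.sum_comm]
  refine Finset.sum_congr rfl fun a _ => ?_
  rw [Finset.sum_comm]
  exact Finset.sum_congr rfl fun b _ => Finset.sum_comm

/-- Fox type derivatives: the first letter of the differentials of `p` can be split off, and the
same coefficients express `p` modulo the section `τ`. -/
theorem exists_fox_derivatives
    (hτ : ∀ p, FreeAlgebra.lift k Y (τ (FreeAlgebra.lift k Y p)) = FreeAlgebra.lift k Y p)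
    (p : FreeAlgebra k (Fin g)) :
    ∃ d : Fin g → Fin s → Fin s → FreeAlgebra k (Fin g),
      (∀ (n : ℕ) (v : Point k g s) (z : ℕ → Point k g s) (a c : Fin s),
        (taylor Y p).app (n + 1) (ins 0 v z) a c =
          ∑ j, ∑ b, ∑ e, v j b e * (taylor Y (d j a b)).app n z e c) ∧
      ∀ q, ∑ j, ∑ a, ∑ b, sectionDefect Y τ j (FreeAlgebra.lift k Y q * Matrix.single a b 1) *
          d j a b = τ (FreeAlgebra.lift k Y q) * p - τ (FreeAlgebra.lift k Y (q * p)) := by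
  induction p using FreeAlgebra.induction with
  | grade0 r =>
    refine ⟨0, fun n v z a c => ?_, fun q => ?_⟩
    · rw [AlgHom.commutes, Algebra.algebraMap_eq_smul_one]
      simp [MultiSeq.app_smul, MultiSeq.app_one, MultiSeq.app_zero]
    · simp [← Algebra.commutes r, ← Algebra.smul_def]
  | grade1 i =>
    refine ⟨fun j a b => if i = j ∧ a = b then 1 else 0, fun n v z a c => ?_, fun q => ?_⟩
    · have : ∀ j b e, v j b e * (taylor Y (if i = j ∧ a = b then 1 else 0)).app n z e c =
          if i = j then (if a = b then (if e = c then (if n = 0 then v j b e else 0) else 0) else 0)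
            else 0 := by
        intro j b e
        by_cases h1 : i = j <;> by_cases h2 : a = b <;> by_cases h3 : n = 0 <;>
          by_cases h4 : e = c <;>
          simp [h1, h2, h3, h4, MultiSeq.app_one, MultiSeq.app_zero]
      simp only [this]
      rw [taylor_ι]
      rcases n with _ | n
      · simp [app_coordSeq_one]
      · simp [app_coordSeq_add_two]
    · have : ∀ j a b, sectionDefect Y τ j (FreeAlgebra.lift k Y q * Matrix.single a b 1) *
          (if i = j ∧ a = b then (1 : FreeAlgebra k (Fin g)) else 0) =
          if i = j then (if a = b then
            sectionDefect Y τ j (FreeAlgebra.lift k Y q * Matrix.single a b 1) else 0) else 0 := by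
        intro j a b
        by_cases h1 : i = j <;> by_cases h2 : a = b <;> simp [h1, h2]
      simp only [this, Finset.sum_ite_eq, Finset.mem_univ, if_true, Finset.sum_ite_irrel,
        Finset.sum_const_zero]
      rw [← map_sum, ← Finset.mul_sum, Matrix.sum_single_one, mul_one, section_eval_mul_ι hτ]
  | add p₁ p₂ h₁ h₂ =>
    obtain ⟨d₁, h₁, h₁'⟩ := h₁
    obtain ⟨d₂, h₂, h₂'⟩ := h₂
    refine ⟨d₁ + d₂, fun n v z a c => ?_, fun q => ?_⟩
    · simp only [map_add, MultiSeq.app_add, Matrix.add_apply, Pi.add_apply, h₁, h₂, mul_add,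
        Finset.sum_add_distrib]
    · simp only [Pi.add_apply, mul_add, Finset.sum_add_distrib, h₁', h₂', map_add]
      abel
  | mul p₁ p₂ h₁ h₂ =>
    obtain ⟨d₁, h₁, h₁'⟩ := h₁
    obtain ⟨d₂, h₂, h₂'⟩ := h₂
    -- The Fox product rule: letters of p₂ have p₁ to their left, evaluated at Y, while letters of
    -- p₁ keep p₂ on the right.
    refine ⟨fun j a b => ∑ c, FreeAlgebra.lift k Y p₁ a c • d₂ j c b + d₁ j a b * p₂,
      fun n v z a c => ?_, fun q => ?_⟩
    · have hsum : ∀ (N : ℕ) (w : ℕ → Point k g s) (f : Fin s → FreeAlgebra k (Fin g)),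
          (taylor Y (∑ c, f c)).app N w = ∑ c, (taylor Y (f c)).app N w := by
        intro N w f
        let L : FreeAlgebra k (Fin g) →+ Matrix (Fin s) (Fin s) k :=
          { toFun := fun p => (taylor Y p).app N w
            map_zero' := by rw [map_zero, MultiSeq.app_zero]
            map_add' := fun x y => by rw [map_add, MultiSeq.app_add] }
        exact map_sum L f _
      rw [map_mul, MultiSeq.app_mul_succ, Matrix.add_apply, Matrix.mul_apply, Matrix.sum_apply]
      simp only [map_add, MultiSeq.app_add, hsum, map_smul, MultiSeq.app_smul, Matrix.add_apply,
        mul_add, Finset.sum_add_distrib, Matrix.sum_apply, Matrix.smul_apply, smul_eq_mul,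
        taylor_app_zero, h₂]
      congr 1
      · simp only [Finset.mul_sum]
        rw [Finset.sum_comm]
        refine Finset.sum_congr rfl fun j _ => ?_
        rw [Finset.sum_comm]
        refine Finset.sum_congr rfl fun b _ => ?_
        rw [Finset.sum_comm]
        refine Finset.sum_congr rfl fun e _ => ?_
        refine Finset.sum_congr rfl fun x _ => ?_
        ring
      · simp only [map_mul, MultiSeq.app_mul, Matrix.sum_apply, Matrix.mul_apply, h₁,
          Finset.mul_sum, Finset.sum_mul]
        refine Eq.trans ?_ (sum_comm_three _ _)
        refine Finset.sum_congr rfl fun i _ => ?_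
        refine Eq.trans ?_ (sum_comm_three _ _)
        simp only [mul_assoc]
    · have e1 : ∀ j, ∑ a, ∑ b, sectionDefect Y τ j (FreeAlgebra.lift k Y q * Matrix.single a b 1) *
          (∑ c, FreeAlgebra.lift k Y p₁ a c • d₂ j c b) =
          ∑ c, ∑ b, sectionDefect Y τ j (FreeAlgebra.lift k Y (q * p₁) * Matrix.single c b 1) *
            d₂ j c b := by
        intro j
        have e2 : ∀ c b, FreeAlgebra.lift k Y (q * p₁) * Matrix.single c b 1 =
            ∑ a, FreeAlgebra.lift k Y p₁ a c •
              (FreeAlgebra.lift k Y q * Matrix.single a b (1 : k)) := by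
          intro c b
          simp only [← Matrix.mul_smul, ← Finset.mul_sum]
          rw [map_mul, mul_assoc]
          congr 1
          ext x y
          rw [Matrix.sum_apply, Matrix.mul_apply]
          simp [Matrix.single_apply, ite_and]
        simp only [e2, map_sum, map_smul, Finset.sum_mul, Finset.mul_sum, smul_mul_assoc,
          mul_smul_comm]
        rw [Finset.sum_comm]
        conv_rhs => rw [Finset.sum_comm]
        exact Finset.sum_congr rfl fun b _ => Finset.sum_comm
      simp only [mul_add, Finset.sum_add_distrib]
      simp only [e1]
      -- Here the sum telescopes: p₂ is handled with prefix q p₁, p₁ with prefix q, and the terms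
      -- τ((q p₁)(Y)) p₂ cancel.
      rw [h₂' (q * p₁)]
      have := congrArg (· * p₂) (h₁' q)
      simp only [Finset.sum_mul, mul_assoc] at this
      rw [this, sub_mul, mul_assoc, mul_assoc]
      abel

/-- With p(Y) = 0 and q = 1, the Fox identity reads p = (1 - τ(1))p + ∑ D_j(E_ab) d_jab. The left
factors lie in the ideal, the right factors in its power one lower by induction. -/
theorem mem_pow_of_taylor_eq_zero (Y : Point k g s) :
    ∀ (ℓ : ℕ) (p : FreeAlgebra k (Fin g)), (∀ m ≤ ℓ, ∀ z, (taylor Y p).app m z = 0) →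
      p ∈ vanishingIdeal Y ^ (ℓ + 1) := by
  obtain ⟨τ, hτ⟩ := exists_evaluation_section Y
  have h1 : ∀ p, (∀ z, (taylor Y p).app 0 z = 0) → p ∈ vanishingIdeal Y := by
    intro p hp
    rw [mem_vanishingIdeal_iff, ← taylor_app_zero Y p (fun _ => 0), hp]
  intro ℓ
  induction ℓ with
  | zero =>
    intro p hp
    rw [zero_add, Submodule.pow_one]
    exact h1 p (hp 0 le_rfl)
  | succ ℓ ih =>
    intro p hp
    obtain ⟨d, hd, hd'⟩ := exists_fox_derivatives hτ p
    have hpI : FreeAlgebra.lift k Y p = 0 := h1 p (hp 0 (Nat.zero_le _))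
    have hp' := ih p fun m hm => hp m (by omega)
    have hdI : ∀ j a b, d j a b ∈ vanishingIdeal Y ^ (ℓ + 1) := by
      intro j a b
      refine ih _ fun m hm z => ?_
      ext e c
      -- A matrix unit in the first argument isolates one entry of one differential of `d j a b`.
      have := hd m (Pi.single j (Matrix.single b e 1)) z a c
      rw [hp (m + 1) (by omega)] at this
      rw [Finset.sum_eq_single j, Finset.sum_eq_single b, Finset.sum_eq_single e] at this
      · simpa using this.symm
      · intro e' _ he'; simp [he'.symm]
      · simp
      · intro b' _ hb'; simp [hb'.symm]
      · simp
      · intro j' _ hj'; simp [Pi.single_eq_of_ne hj']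
      · simp
    have hone : 1 - τ 1 ∈ vanishingIdeal Y := by
      rw [mem_vanishingIdeal_iff, map_sub, map_one]
      have := hτ 1
      rw [map_one] at this
      rw [this, sub_self]
    have hp1 : p = (1 - τ 1) * p +
        ∑ j, ∑ a, ∑ b, sectionDefect Y τ j (Matrix.single a b 1) * d j a b := by
      have := hd' 1
      simp only [one_mul, map_one, hpI, map_zero, sub_zero] at this
      rw [this, sub_mul, one_mul, sub_add_cancel]
    rw [Ideal.IsTwoSided.pow_succ, hp1]
    refine add_mem (Ideal.mul_mem_mul hone hp') ?_
    exact sum_mem fun j _ => sum_mem fun a _ => sum_mem fun b _ =>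
      Ideal.mul_mem_mul (sectionDefect_mem hτ j _) (hdI j a b)

theorem mem_pow_iff (Y : Point k g s) (ℓ : ℕ) (p : FreeAlgebra k (Fin g)) :
    p ∈ vanishingIdeal Y ^ ℓ ↔ ∀ m < ℓ, ∀ z, (taylor Y p).app m z = 0 := by
  refine ⟨taylor_app_eq_zero_of_mem_pow Y ℓ p, fun h => ?_⟩
  rcases ℓ with _ | ℓ
  · rw [Submodule.pow_zero, Ideal.one_eq_top]
    trivial
  · exact mem_pow_of_taylor_eq_zero Y ℓ p fun m hm => h m (by omega)

theorem higherVanishingIdeal_eq_pow (Y : Point k g s) (ℓ : ℕ) :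
    higherVanishingIdeal Y ℓ = vanishingIdeal Y ^ (ℓ + 1) := by
  ext p
  rw [mem_higherVanishingIdeal_iff, mem_pow_iff]
  simp only [Nat.lt_succ_iff]

end Vanishing

/-! ### Leading terms of germs about semisimple points -/

section Leading

variable {k : Type*} [Field k] {g s : ℕ}

/-- A linear map on matrices in terms of its values on matrix units. -/
theorem map_eq_sum_single (F : Matrix (Fin s) (Fin s) k →ₗ[k] Matrix (Fin s) (Fin s) k)
    (X : Matrix (Fin s) (Fin s) k) :
    ∑ r : Fin s × Fin s × Fin s, Matrix.single r.2.2 r.1 1 * X *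
      (Matrix.single r.2.1 r.2.2 1 * F (Matrix.single r.1 r.2.1 1)) = F X := by
  -- One has E_ca X E_bc = X_ab E_cc, and the sum over c produces the identity matrix.
  have h : ∀ a b c, Matrix.single c a 1 * X * (Matrix.single b c 1 * F (Matrix.single a b 1)) =
      X a b • (Matrix.single c c 1 * F (Matrix.single a b 1)) := by
    intro a b c
    rw [← mul_assoc, Matrix.single_mul_mul_single, ← smul_mul_assoc, Matrix.smul_single]
    simp
  simp only [Fintype.sum_prod_type, h, ← Finset.smul_sum, ← Finset.sum_mul, Matrix.sum_single_one,
    one_mul]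
  conv_rhs => rw [Matrix.matrix_eq_sum_single X]
  simp only [map_sum]
  refine Finset.sum_congr rfl fun a _ => Finset.sum_congr rfl fun b _ => ?_
  rw [← map_smul, Matrix.smul_single, smul_eq_mul, mul_one]

/-! ### Identities in the tensor square of the matrix algebra -/

section Balanced

variable {κ κ' : Type*} [Fintype κ] [Fintype κ'] {a b : κ → Matrix (Fin s) (Fin s) k}
  {a' b' : κ' → Matrix (Fin s) (Fin s) k}

/-- The hypothesis means ∑ a_r ⊗ b_r = ∑ a'_r ⊗ b'_r; matrix units for S extract the coordinates.
The next two lemmas apply linear maps to one tensor factor. -/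
theorem sum_entry_mul_entry (h : ∀ S, ∑ r, a r * S * b r = ∑ r, a' r * S * b' r)
    (x y v w : Fin s) :
    ∑ r, a r x y * b r v w = ∑ r, a' r x y * b' r v w := by
  have e : ∀ A B : Matrix (Fin s) (Fin s) k,
      (A * (Matrix.single y v 1 : Matrix (Fin s) (Fin s) k) * B) x w = A x y * B v w := by
    intro A B
    rw [Matrix.mul_apply, Finset.sum_eq_single v]
    · simp
    · intro c _ hc
      simp [hc]
    · simp
  have := congrFun (congrFun (h (Matrix.single y v 1)) x) w
  simpa only [Matrix.sum_apply, e] using this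

theorem sum_map_mul (h : ∀ S, ∑ r, a r * S * b r = ∑ r, a' r * S * b' r)
    (F : Matrix (Fin s) (Fin s) k →ₗ[k] Matrix (Fin s) (Fin s) k) :
    ∑ r, F (a r) * b r = ∑ r, F (a' r) * b' r := by
  have e : ∀ A B : Matrix (Fin s) (Fin s) k, ∀ p w, (F A * B) p w =
      ∑ v, ∑ x, ∑ y, F (Matrix.single x y 1) p v * (A x y * B v w) := by
    intro A B p w
    conv_lhs => rw [Matrix.matrix_eq_sum_single A]
    simp only [map_sum, Finset.sum_mul, Matrix.sum_apply, Matrix.mul_apply]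
    refine Finset.sum_congr rfl fun v _ => Finset.sum_congr rfl fun x _ =>
      Finset.sum_congr rfl fun y _ => ?_
    rw [show Matrix.single x y (A x y) = A x y • Matrix.single x y (1 : k) by
      rw [Matrix.smul_single, smul_eq_mul, mul_one], map_smul, Matrix.smul_apply, smul_eq_mul]
    ring
  ext p w
  simp only [Matrix.sum_apply, e]
  refine (sum_comm_three _ _).trans (Eq.trans ?_ (sum_comm_three _ _).symm)
  simp only [← Finset.mul_sum, sum_entry_mul_entry h]

theorem sum_mul_map (h : ∀ S, ∑ r, a r * S * b r = ∑ r, a' r * S * b' r)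
    (F : Matrix (Fin s) (Fin s) k →ₗ[k] Matrix (Fin s) (Fin s) k) :
    ∑ r, a r * F (b r) = ∑ r, a' r * F (b' r) := by
  have e : ∀ A B : Matrix (Fin s) (Fin s) k, ∀ p w, (A * F B) p w =
      ∑ v, ∑ x, ∑ y, F (Matrix.single x y 1) v w * (A p v * B x y) := by
    intro A B p w
    conv_lhs => rw [Matrix.matrix_eq_sum_single B]
    simp only [map_sum, Finset.mul_sum, Matrix.sum_apply, Matrix.mul_apply]
    refine Finset.sum_congr rfl fun v _ => Finset.sum_congr rfl fun x _ =>
      Finset.sum_congr rfl fun y _ => ?_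
    rw [show Matrix.single x y (B x y) = B x y • Matrix.single x y (1 : k) by
      rw [Matrix.smul_single, smul_eq_mul, mul_one], map_smul, Matrix.smul_apply, smul_eq_mul]
    ring
  ext p w
  simp only [Matrix.sum_apply, e]
  refine (sum_comm_three _ _).trans (Eq.trans ?_ (sum_comm_three _ _).symm)
  simp only [← Finset.mul_sum, sum_entry_mul_entry h]

end Balanced

/-- The bilinear map `(S, Z) ↦ S Z`. -/
def lmulHom : Matrix (Fin s) (Fin s) k →ₗ[k] Point k g s →ₗ[k] Point k g s :=
  LinearMap.mk₂ k lmul (fun _ _ _ => by funext j; simp [lmul, add_mul])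
    (fun _ _ _ => by funext j; simp [lmul]) (fun _ _ _ => by funext j; simp [lmul, mul_add])
    (fun _ _ _ => by funext j; simp [lmul])

/-- The bilinear map `(Z, S) ↦ Z S`. -/
def rmulHom : Point k g s →ₗ[k] Matrix (Fin s) (Fin s) k →ₗ[k] Point k g s :=
  LinearMap.mk₂ k rmul (fun _ _ _ => by funext j; simp [rmul, add_mul])
    (fun _ _ _ => by funext j; simp [rmul]) (fun _ _ _ => by funext j; simp [rmul, mul_add])
    (fun _ _ _ => by funext j; simp [rmul])

/-- The linear map `S ↦ [S, Y]`. -/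
def commHom (Y : Point k g s) : Matrix (Fin s) (Fin s) k →ₗ[k] Point k g s :=
  lmulHom.flip Y - rmulHom Y

theorem lmul_lmul (S T : Matrix (Fin s) (Fin s) k) (Z : Point k g s) :
    lmul S (lmul T Z) = lmul (S * T) Z := funext fun _ => (mul_assoc _ _ _).symm

theorem rmul_rmul (S T : Matrix (Fin s) (Fin s) k) (Z : Point k g s) :
    rmul (rmul Z S) T = rmul Z (S * T) := funext fun _ => mul_assoc _ _ _

theorem rmul_lmul (S T : Matrix (Fin s) (Fin s) k) (Z : Point k g s) :
    rmul (lmul S Z) T = lmul S (rmul Z T) := funext fun _ => mul_assoc _ _ _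

theorem lmul_comm_point {Y : Point k g s} {c : Matrix (Fin s) (Fin s) k}
    (hc : ∀ j, c * Y j = Y j * c) (S : Matrix (Fin s) (Fin s) k) :
    lmul c (comm S Y) = comm (c * S) Y := by
  funext j
  simp only [lmul, comm, mul_sub, ← mul_assoc, hc]

theorem rmul_comm_point {Y : Point k g s} {c : Matrix (Fin s) (Fin s) k}
    (hc : ∀ j, c * Y j = Y j * c) (S : Matrix (Fin s) (Fin s) k) :
    rmul (comm S Y) c = comm (S * c) Y := by
  funext j
  simp only [rmul, comm, sub_mul, mul_assoc, hc]

/-! ### Averages over the centralizer and first-order terms -/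

namespace AveragingFamily

variable {Y : Point k g s} (e : AveragingFamily Y)

/-- The average `∑ u_i X v_i`. -/
def mean (X : Matrix (Fin s) (Fin s) k) : Matrix (Fin s) (Fin s) k := ∑ i, e.u i * X * e.v i

theorem mul_mean {c : Matrix (Fin s) (Fin s) k} (hc : ∀ j, c * Y j = Y j * c)
    (X : Matrix (Fin s) (Fin s) k) : c * e.mean X = e.mean X * c := by
  simpa only [mean, Finset.mul_sum, Finset.sum_mul, mul_assoc] using e.balanced c hc X

theorem mean_eq_self {X : Matrix (Fin s) (Fin s) k}
    (hX : ∀ c, (∀ j, c * Y j = Y j * c) → c * X = X * c) : e.mean X = X := by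
  have : ∀ i, e.u i * X * e.v i = X * (e.u i * e.v i) := fun i => by
    rw [hX _ (e.u_comm i), mul_assoc]
  simp only [mean, this, ← Finset.mul_sum, e.sum_mul, mul_one]

theorem balanced_left {c : Matrix (Fin s) (Fin s) k} (hc : ∀ j, c * Y j = Y j * c)
    (F : Matrix (Fin s) (Fin s) k →ₗ[k] Matrix (Fin s) (Fin s) k) :
    ∑ i, F (c * e.u i) * e.v i = ∑ i, F (e.u i) * (e.v i * c) :=
  sum_map_mul (a := fun i => c * e.u i) (b := e.v) (a' := e.u) (b' := fun i => e.v i * c)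
    (e.balanced c hc) F

theorem balanced_right {c : Matrix (Fin s) (Fin s) k} (hc : ∀ j, c * Y j = Y j * c)
    (F : Matrix (Fin s) (Fin s) k →ₗ[k] Matrix (Fin s) (Fin s) k) :
    ∑ i, c * e.u i * F (e.v i) = ∑ i, e.u i * F (e.v i * c) :=
  sum_mul_map (a := fun i => c * e.u i) (b := e.v) (a' := e.u) (b' := fun i => e.v i * c)
    (e.balanced c hc) F

/-- The average `Z ↦ ∑ u_i φ (v_i Z u_j) v_j` of a linear map. -/
def biMean (φ : Point k g s →ₗ[k] Matrix (Fin s) (Fin s) k) :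
    Point k g s →ₗ[k] Matrix (Fin s) (Fin s) k :=
  ∑ i, ∑ j, LinearMap.mulRight k (e.v j) ∘ₗ LinearMap.mulLeft k (e.u i) ∘ₗ φ ∘ₗ
    lmulHom (e.v i) ∘ₗ rmulHom.flip (e.u j)

theorem biMean_apply (φ : Point k g s →ₗ[k] Matrix (Fin s) (Fin s) k) (Z : Point k g s) :
    e.biMean φ Z = ∑ i, ∑ j, e.u i * φ (lmul (e.v i) (rmul Z (e.u j))) * e.v j := by
  simp only [biMean, LinearMap.sum_apply]
  rfl

/-- Balancedness moves c from the right of v_i to the left of u_i, whatever the linear map between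
them. -/
theorem biMean_lmul (φ : Point k g s →ₗ[k] Matrix (Fin s) (Fin s) k)
    {c : Matrix (Fin s) (Fin s) k} (hc : ∀ j, c * Y j = Y j * c) (Z : Point k g s) :
    e.biMean φ (lmul c Z) = c * e.biMean φ Z := by
  simp only [biMean_apply, rmul_lmul, lmul_lmul]
  rw [Finset.sum_comm]
  conv_rhs => rw [Finset.sum_comm]
  simp only [Finset.mul_sum]
  refine Finset.sum_congr rfl fun j _ => ?_
  simp only [← mul_assoc, ← Finset.sum_mul]
  congr 1
  exact (e.balanced_right hc (φ ∘ₗ lmulHom.flip (rmul Z (e.u j)))).symm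

theorem biMean_rmul (φ : Point k g s →ₗ[k] Matrix (Fin s) (Fin s) k)
    {c : Matrix (Fin s) (Fin s) k} (hc : ∀ j, c * Y j = Y j * c) (Z : Point k g s) :
    e.biMean φ (rmul Z c) = e.biMean φ Z * c := by
  simp only [biMean_apply, rmul_rmul, Finset.sum_mul]
  refine Finset.sum_congr rfl fun i _ => ?_
  simp only [mul_assoc, ← Finset.mul_sum]
  congr 1
  exact e.balanced_left hc (φ ∘ₗ lmulHom (e.v i) ∘ₗ rmulHom Z)

theorem biMean_comm_point {φ : Point k g s →ₗ[k] Matrix (Fin s) (Fin s) k}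
    (hφ : ∀ S, φ (comm S Y) = 0) (S : Matrix (Fin s) (Fin s) k) : e.biMean φ (comm S Y) = 0 := by
  simp only [biMean_apply, rmul_comm_point (e.u_comm _), lmul_comm_point (e.v_comm _), hφ, mul_zero,
    zero_mul, Finset.sum_const_zero]

theorem biMean_eq_self {φ : Point k g s →ₗ[k] Matrix (Fin s) (Fin s) k}
    (hl : ∀ c, (∀ j, c * Y j = Y j * c) → ∀ Z, φ (lmul c Z) = c * φ Z)
    (hr : ∀ c, (∀ j, c * Y j = Y j * c) → ∀ Z, φ (rmul Z c) = φ Z * c) :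
    e.biMean φ = φ := by
  refine LinearMap.ext fun Z => ?_
  have : ∀ i j, e.u i * φ (lmul (e.v i) (rmul Z (e.u j))) * e.v j =
      e.u i * e.v i * (φ Z * (e.u j * e.v j)) := by
    intro i j
    rw [hl _ (e.v_comm i), hr _ (e.u_comm j)]
    simp only [mul_assoc]
  simp only [biMean_apply, this, ← Finset.mul_sum, ← Finset.sum_mul, e.sum_mul, one_mul, mul_one]

/-- The tuples `[S, Y]` have a complement that is stable under the centralizer of `Y`. -/
theorem exists_projection (e : AveragingFamily Y) :
    ∃ Q : Fin g → Point k g s →ₗ[k] Matrix (Fin s) (Fin s) k,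
      (∀ j S, Q j (comm S Y) = 0) ∧
      (∀ j c, (∀ j, c * Y j = Y j * c) → ∀ Z, Q j (lmul c Z) = c * Q j Z) ∧
      (∀ j c, (∀ j, c * Y j = Y j * c) → ∀ Z, Q j (rmul Z c) = Q j Z * c) ∧
      ∀ Z, ∃ S, Z = (fun j => Q j Z) + comm S Y := by
  obtain ⟨σ, hσ⟩ := (commHom Y).rangeRestrict.exists_rightInverse_of_surjective
    (commHom Y).range_rangeRestrict
  obtain ⟨τ, hτ⟩ := σ.exists_extend
  have hsec : ∀ S, commHom Y (τ (commHom Y S)) = commHom Y S := by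
    intro S
    have h1 : τ (commHom Y S) = σ ⟨commHom Y S, ⟨S, rfl⟩⟩ :=
      LinearMap.congr_fun hτ ⟨commHom Y S, ⟨S, rfl⟩⟩
    rw [h1]
    exact congrArg Subtype.val (LinearMap.congr_fun hσ ⟨commHom Y S, ⟨S, rfl⟩⟩)
  -- Any linear projection that kills the tuples [S, Y]; bi-averaging makes it a bimodule map while
  -- changing Z only by some [S, Y].
  let Q₀ : Fin g → Point k g s →ₗ[k] Matrix (Fin s) (Fin s) k := fun j =>
    LinearMap.proj j ∘ₗ (LinearMap.id - commHom Y ∘ₗ τ)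
  have hQ₀ : ∀ j Z, Q₀ j Z = Z j - comm (τ Z) Y j := fun _ _ => rfl
  refine ⟨fun j => e.biMean (Q₀ j), fun j S => e.biMean_comm_point (fun S => ?_) S,
    fun j c hc Z => e.biMean_lmul _ hc Z, fun j c hc Z => e.biMean_rmul _ hc Z, fun Z =>
    ⟨∑ i, ∑ j, e.u i * τ (lmul (e.v i) (rmul Z (e.u j))) * e.v j, ?_⟩⟩
  · rw [hQ₀]
    exact sub_eq_zero.2 (congrFun (hsec S) j).symm
  · funext j
    have h1 : e.biMean (LinearMap.proj j : Point k g s →ₗ[k] Matrix (Fin s) (Fin s) k) Z = Z j := by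
      rw [e.biMean_eq_self (fun _ _ _ => rfl) fun _ _ _ => rfl]
      rfl
    have h2 : Z j = ∑ i, ∑ i', e.u i * lmul (e.v i) (rmul Z (e.u i')) j * e.v i' := by
      rw [← h1, biMean_apply]
      rfl
    have h3 : comm (∑ i, ∑ i', e.u i * τ (lmul (e.v i) (rmul Z (e.u i'))) * e.v i') Y j =
        ∑ i, ∑ i', e.u i * comm (τ (lmul (e.v i) (rmul Z (e.u i')))) Y j * e.v i' := by
      simp only [comm, Finset.sum_mul, Finset.mul_sum, ← Finset.sum_sub_distrib]
      refine Finset.sum_congr rfl fun i _ => Finset.sum_congr rfl fun i' _ => ?_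
      rw [mul_sub, sub_mul, ← mul_assoc, ← mul_assoc, ← mul_assoc, ← e.u_comm]
      simp only [mul_assoc, e.v_comm]
    rw [Pi.add_apply, h3, biMean_apply]
    conv_lhs => rw [h2]
    simp only [← Finset.sum_add_distrib, hQ₀, mul_sub, sub_mul, sub_add_cancel]

/-- A linear map that commutes with the centralizer of `Y` and vanishes on all `[S, Y]` is the
first differential of a polynomial that vanishes at `Y`. -/
theorem exists_taylor_one (e : AveragingFamily Y) {φ : Point k g s →ₗ[k] Matrix (Fin s) (Fin s) k}
    (hl : ∀ c, (∀ j, c * Y j = Y j * c) → ∀ Z, φ (lmul c Z) = c * φ Z)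
    (hr : ∀ c, (∀ j, c * Y j = Y j * c) → ∀ Z, φ (rmul Z c) = φ Z * c)
    (h0 : ∀ S, φ (comm S Y) = 0) :
    ∃ h ∈ vanishingIdeal Y, ∀ z, (taylor Y h).app 1 z = φ (z 0) := by
  obtain ⟨τ, hτ⟩ := exists_evaluation_section Y
  let κ := Fin g × Fin s × Fin s × Fin s
  let A : κ → Matrix (Fin s) (Fin s) k := fun r => e.mean (Matrix.single r.2.2.2 r.2.1 1)
  let B : κ → Matrix (Fin s) (Fin s) k := fun r => e.mean
    (Matrix.single r.2.2.1 r.2.2.2 1 * φ (Pi.single r.1 (Matrix.single r.2.1 r.2.2.1 1)))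
  -- Every linear map is a sum of two-sided multiplications; averaging puts both coefficients into
  -- the algebra generated by Y.
  have hφ : ∀ Z, φ Z = ∑ r, A r * Z r.1 * B r := by
    intro Z
    have h1 : ∀ W, φ W = ∑ j, ∑ r : Fin s × Fin s × Fin s, Matrix.single r.2.2 r.1 1 * W j *
        (Matrix.single r.2.1 r.2.2 1 * φ (Pi.single j (Matrix.single r.1 r.2.1 1))) := by
      intro W
      conv_lhs => rw [← Finset.univ_sum_single W, map_sum]
      refine Finset.sum_congr rfl fun j _ => ?_
      exact (map_eq_sum_single
        (φ ∘ₗ LinearMap.single k (fun _ : Fin g => Matrix (Fin s) (Fin s) k) j) (W j)).symm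
    conv_lhs => rw [← e.biMean_eq_self hl hr, biMean_apply]
    have h1' : ∀ i i', e.u i * φ (lmul (e.v i) (rmul Z (e.u i'))) * e.v i' =
        ∑ j, ∑ r : Fin s × Fin s × Fin s, e.u i * (Matrix.single r.2.2 r.1 1 *
          lmul (e.v i) (rmul Z (e.u i')) j * (Matrix.single r.2.1 r.2.2 1 *
            φ (Pi.single j (Matrix.single r.1 r.2.1 1)))) * e.v i' := by
      intro i i'
      rw [h1 (lmul _ _)]
      simp only [Finset.mul_sum, Finset.sum_mul]
    simp only [h1']
    rw [Fintype.sum_prod_type]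
    have h2 : ∀ F : Fin e.n → Fin e.n → Fin g → Fin s × Fin s × Fin s → Matrix (Fin s) (Fin s) k,
        ∑ i, ∑ i', ∑ j, ∑ r, F i i' j r = ∑ j, ∑ r, ∑ i, ∑ i', F i i' j r := by
      intro F
      simp only [← Fintype.sum_prod_type']
      exact Fintype.sum_equiv
        { toFun := fun x => (x.2.2.1, x.2.2.2, x.1, x.2.1)
          invFun := fun x => (x.2.2.1, x.2.2.2, x.1, x.2.1)
          left_inv := fun _ => rfl
          right_inv := fun _ => rfl } _ _ fun _ => rfl
    rw [h2]
    refine Finset.sum_congr rfl fun j _ => Finset.sum_congr rfl fun r _ => ?_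
    simp only [A, B, mean, Finset.mul_sum, Finset.sum_mul, lmul, rmul, mul_assoc]
    rw [Finset.sum_comm]
  choose q hq using fun r : κ => e.mean_mem
    (Matrix.single r.2.2.1 r.2.2.2 1 * φ (Pi.single r.1 (Matrix.single r.2.1 r.2.2.1 1)))
  have hqB : ∀ r : κ, FreeAlgebra.lift k Y (q r) = B r := hq
  have hτA : ∀ r, FreeAlgebra.lift k Y (τ (A r)) = A r := by
    intro r
    obtain ⟨p, hp⟩ := e.mean_mem (Matrix.single r.2.2.2 r.2.1 1)
    have hp' : FreeAlgebra.lift k Y p = A r := hp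
    rw [← hp', hτ]
  refine ⟨∑ r, sectionDefect Y τ r.1 (A r) * q r, sum_mem fun r _ =>
    Ideal.mul_mem_right _ _ (sectionDefect_mem hτ _ _), fun z => ?_⟩
  let δ : Matrix (Fin s) (Fin s) k →ₗ[k] Matrix (Fin s) (Fin s) k :=
    { toFun := fun m => (taylor Y (τ m)).app 1 z
      map_add' := fun x y => by rw [map_add, map_add, MultiSeq.app_add]
      map_smul' := fun c x => by rw [map_smul, map_smul, MultiSeq.app_smul, RingHom.id_apply] }
  let L : FreeAlgebra k (Fin g) →+ Matrix (Fin s) (Fin s) k :=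
    { toFun := fun p => (taylor Y p).app 1 z
      map_zero' := by rw [map_zero, MultiSeq.app_zero]
      map_add' := fun x y => by rw [map_add, MultiSeq.app_add] }
  -- Besides the wanted term, differentiating τ leaves δ(A_r)Y_jB_r - δ(A_rY_j)B_r. Vanishing of φ
  -- on all [S, Y] says that ∑ A_r ⊗ Y_jB_r = ∑ A_rY_j ⊗ B_r, so these corrections cancel in total.
  have hL : ∀ r, L (sectionDefect Y τ r.1 (A r) * q r) =
      A r * z 0 r.1 * B r + (δ (A r) * (Y r.1 * B r) - δ (A r * Y r.1) * B r) := by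
    intro r
    have h1 := taylor_app_eq_zero_of_mem_pow Y 1 _
      (by rw [Submodule.pow_one]; exact sectionDefect_mem hτ r.1 (A r))
    change (taylor Y _).app 1 z = _
    rw [map_mul, MultiSeq.app_mul_of_order (a := 1) (b := 0) h1
      (fun m hm => absurd hm (Nat.not_lt_zero m)) 1 le_rfl, if_pos rfl, taylor_app_zero, hqB,
      sectionDefect_apply, hτA]
    have h2 : L (τ (A r) * FreeAlgebra.ι k r.1 - τ (A r * Y r.1)) =
        A r * z 0 r.1 + δ (A r) * Y r.1 - δ (A r * Y r.1) := by
      rw [map_sub]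
      congr 1
      change (taylor Y _).app 1 z = _
      rw [map_mul, MultiSeq.app_mul, taylor_ι]
      simp [Finset.sum_range_succ, taylor_app_zero, hτA, app_coordSeq_one, app_coordSeq_zero, δ]
    change L _ * _ = _
    rw [h2, sub_mul, add_mul, mul_assoc (δ _), add_sub_assoc]
  change L _ = _
  rw [map_sum]
  simp only [hL, Finset.sum_add_distrib, ← hφ, Finset.sum_sub_distrib]
  rw [sum_map_mul (a := A) (b := fun r => Y r.1 * B r) (a' := fun r => A r * Y r.1) (b' := B), sub_self,
    add_zero]
  intro S
  have := h0 S
  simp only [hφ, comm, mul_sub, sub_mul, Finset.sum_sub_distrib, sub_eq_zero] at this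
  simpa only [mul_assoc] using this

end AveragingFamily

variable {Y : Point k g s}

theorem cons_eq_ins {V : Type*} (n : ℕ) (v : V) (z : ℕ → V) :
    (Fin.cons v (fun i : Fin n => z i) : Fin (n + 1) → V) =
      fun i : Fin (n + 1) => ins 0 v z i := by
  funext i
  refine Fin.cases ?_ (fun i => ?_) i <;> simp

/-- The homogeneous form of the intertwining conditions, satisfied by the leading term of a germ. -/
structure IsLeading (Y : Point k g s) {n : ℕ}
    (f : MultilinearMap k (fun _ : Fin n => Point k g s) (Matrix (Fin s) (Fin s) k)) : Prop where
  vanish : ∀ p < n, ∀ S, ∀ z : ℕ → Point k g s, z p = comm S Y → f (fun i => z i) = 0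
  balanced : ∀ p ≤ n, ∀ c, (∀ j, c * Y j = Y j * c) → ∀ z : ℕ → Point k g s,
    (if p = 0 then c * f (fun i => z i)
      else f (fun i => Function.update z (p - 1) (rmul (z (p - 1)) c) i)) =
    if p = n then f (fun i => z i) * c else f (fun i => Function.update z p (lmul c (z p)) i)

/-! ### Expansion of leading terms in the first argument -/

namespace AveragingFamily

variable (e : AveragingFamily Y) {n : ℕ}
  (f : MultilinearMap k (fun _ : Fin (n + 1) => Point k g s) (Matrix (Fin s) (Fin s) k))

/-- The coefficients in the expansion of a leading term with respect to the first argument. -/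
def tailCoeff (j : Fin g) (r : Fin s × Fin s × Fin s) :
    MultilinearMap k (fun _ : Fin n => Point k g s) (Matrix (Fin s) (Fin s) k) :=
  ∑ i, (LinearMap.mulLeft k (e.u i * Matrix.single r.2.1 r.2.2 1)).compMultilinearMap
    (f.curryLeft (Pi.single j (Matrix.single r.1 r.2.1 1 * e.v i)))

theorem tailCoeff_apply (j : Fin g) (r : Fin s × Fin s × Fin s) (z : ℕ → Point k g s) :
    e.tailCoeff f j r (fun i => z i) = ∑ i, e.u i * Matrix.single r.2.1 r.2.2 1 *
      f (fun l => ins 0 (Pi.single j (Matrix.single r.1 r.2.1 1 * e.v i)) z l) := by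
  rw [tailCoeff, _root_.sum_apply]
  refine Finset.sum_congr rfl fun i _ => ?_
  rw [← cons_eq_ins]
  rfl

/-- The restriction of `f (·, z)` to the `j`-th coordinate. -/
def headMap (z : ℕ → Point k g s) (j : Fin g) :
    Matrix (Fin s) (Fin s) k →ₗ[k] Matrix (Fin s) (Fin s) k where
  toFun X := f.curryLeft (Pi.single j X) fun i => z i
  map_add' x y := by rw [Pi.single_add, map_add, _root_.add_apply]
  map_smul' c x := by rw [Pi.single_smul, map_smul, _root_.smul_apply, RingHom.id_apply]

theorem headMap_apply (z : ℕ → Point k g s) (j : Fin g) (X : Matrix (Fin s) (Fin s) k) :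
    headMap f z j X = f (fun i => ins 0 (Pi.single j X) z i) := by
  rw [← cons_eq_ins]
  rfl

theorem sum_headMap (z : ℕ → Point k g s) (W : Point k g s) :
    ∑ j, headMap f z j (W j) = f (fun i => ins 0 W z i) := by
  have h1 : ∀ V : Point k g s, f (fun i => ins 0 V z i) = f.curryLeft V (fun i => z i) := by
    intro V
    rw [← cons_eq_ins]
    rfl
  rw [h1]
  conv_rhs => rw [← Finset.univ_sum_single W, map_sum, _root_.sum_apply]
  rfl

variable {f}

/-- The conditions descend from the next slot of f. At slot 0, separability first carries c from the
left of u_i to the right of v_i, into the first argument of f, and balancedness of f passes it on.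
-/
theorem isLeading_tailCoeff (hf : IsLeading Y f) (j : Fin g) (r : Fin s × Fin s × Fin s) :
    IsLeading Y (e.tailCoeff f j r) := by
  refine ⟨fun p hp S z hz => ?_, fun p hp c hc z => ?_⟩
  · rw [tailCoeff_apply]
    refine Finset.sum_eq_zero fun i _ => ?_
    rw [hf.vanish (p + 1) (by omega) S _ (by rw [ins_zero_succ, hz]), mul_zero]
  · have hbal := fun i => hf.balanced (p + 1) (by omega) c hc
      (ins 0 (Pi.single j (Matrix.single r.1 r.2.1 1 * e.v i)) z)
    simp only [Nat.add_sub_cancel, Nat.add_eq_zero_iff, one_ne_zero, and_false, if_false,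
      Nat.add_right_cancel_iff, update_succ_ins_zero, ins_zero_succ] at hbal
    have hR : (if p = n then e.tailCoeff f j r (fun i => z i) * c
        else e.tailCoeff f j r (fun i => Function.update z p (lmul c (z p)) i)) =
        ∑ i, e.u i * Matrix.single r.2.1 r.2.2 1 * (if p = n then
          f (fun l => ins 0 (Pi.single j (Matrix.single r.1 r.2.1 1 * e.v i)) z l) * c
          else f (fun l => ins 0 (Pi.single j (Matrix.single r.1 r.2.1 1 * e.v i))
            (Function.update z p (lmul c (z p))) l)) := by
      split_ifs
      · rw [tailCoeff_apply, Finset.sum_mul]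
        simp only [mul_assoc]
      · rw [tailCoeff_apply]
    rw [hR]
    simp only [← hbal]
    rcases p with _ | p
    · rw [if_pos rfl, tailCoeff_apply, Finset.mul_sum]
      have := e.balanced_right hc (LinearMap.mulLeft k (Matrix.single r.2.1 r.2.2 1) ∘ₗ
        headMap f z j ∘ₗ LinearMap.mulLeft k (Matrix.single r.1 r.2.1 1))
      simp only [LinearMap.comp_apply, LinearMap.mulLeft_apply, headMap_apply] at this
      simp only [← mul_assoc] at this ⊢
      rw [this]
      refine Finset.sum_congr rfl fun i _ => ?_
      rw [ins_zero_zero, update_zero_ins_zero]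
      congr 3
      funext l
      congr 2
      funext j'
      by_cases hj : j' = j
      · subst hj
        simp [rmul]
      · simp [rmul, Pi.single_eq_of_ne hj]
    · rw [if_neg (Nat.succ_ne_zero p), tailCoeff_apply]
      simp only [Nat.add_sub_cancel, update_succ_ins_zero, ins_zero_succ]

/-- Insert ∑ u_i v_i = 1 on both sides of W and expand in matrix units between the two copies;
C-linearity in the first slot absorbs the outer factor. -/
theorem sum_mean_mul_tailCoeff (hf : IsLeading Y f) (W : Point k g s) (z : ℕ → Point k g s) :
    ∑ j, ∑ r : Fin s × Fin s × Fin s, e.mean (Matrix.single r.2.2 r.1 1) * W j *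
      e.tailCoeff f j r (fun i => z i) = f (fun i => ins 0 W z i) := by
  have hlmul : ∀ c, (∀ j, c * Y j = Y j * c) → ∀ V,
      c * f (fun i => ins 0 V z i) = f (fun i => ins 0 (lmul c V) z i) := by
    intro c hc V
    have := hf.balanced 0 (Nat.zero_le _) c hc (ins 0 V z)
    rwa [if_pos rfl, if_neg (Nat.succ_ne_zero n).symm, ins_zero_zero, update_zero_ins_zero] at this
  have h1 : ∀ j, ∑ r : Fin s × Fin s × Fin s, e.mean (Matrix.single r.2.2 r.1 1) * W j *
      e.tailCoeff f j r (fun i => z i) = ∑ i', e.u i' * headMap f z j (e.v i' * W j) := by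
    intro j
    have h2 : ∀ i' i, e.u i' * headMap f z j (e.v i' * W j * e.u i * e.v i) =
        ∑ r : Fin s × Fin s × Fin s, e.u i' * (Matrix.single r.2.2 r.1 1 * (e.v i' * W j * e.u i) *
          (Matrix.single r.2.1 r.2.2 1 * headMap f z j (Matrix.single r.1 r.2.1 1 * e.v i))) := by
      intro i' i
      rw [← Finset.mul_sum]
      exact congrArg (e.u i' * ·) (map_eq_sum_single
        (headMap f z j ∘ₗ LinearMap.mulRight k (e.v i)) (e.v i' * W j * e.u i)).symm
    have h3 : ∀ i', headMap f z j (e.v i' * W j) =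
        ∑ i, headMap f z j (e.v i' * W j * e.u i * e.v i) := by
      intro i'
      simp only [← map_sum, mul_assoc (e.v i' * W j), ← Finset.mul_sum, e.sum_mul, mul_one]
    simp only [h3, Finset.mul_sum, h2]
    have h4 : ∀ F : Fin e.n → Fin e.n → Fin s × Fin s × Fin s → Matrix (Fin s) (Fin s) k,
        ∑ i', ∑ i, ∑ r, F i' i r = ∑ r, ∑ i', ∑ i, F i' i r := by
      intro F
      rw [Finset.sum_comm (s := Finset.univ (α := Fin s × Fin s × Fin s))]
      exact Finset.sum_congr rfl fun i' _ => Finset.sum_comm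
    rw [h4]
    refine Finset.sum_congr rfl fun r _ => ?_
    simp only [tailCoeff_apply, ← headMap_apply, mean, Finset.sum_mul, Finset.mul_sum, mul_assoc]
    rw [Finset.sum_comm]
  simp only [h1]
  rw [Finset.sum_comm]
  have h5 : ∀ i', ∑ j, headMap f z j (e.v i' * W j) = f (fun i => ins 0 (lmul (e.v i') W) z i) :=
    fun i' => sum_headMap f z (lmul (e.v i') W)
  simp only [← Finset.mul_sum, h5, hlmul _ (e.u_comm _), lmul_lmul]
  let L : Matrix (Fin s) (Fin s) k →+ Matrix (Fin s) (Fin s) k :=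
    { toFun := fun c => ∑ j, headMap f z j (c * W j)
      map_zero' := by simp
      map_add' := fun x y => by simp [add_mul, Finset.sum_add_distrib] }
  have hL : ∀ c, f (fun i => ins 0 (lmul c W) z i) = L c :=
    fun c => (sum_headMap f z (lmul c W)).symm
  simp only [hL, ← map_sum, e.sum_mul]
  rw [← hL]
  congr 1
  funext i
  congr 1
  exact funext fun j => one_mul _

/-- A leading term of order `n` is the `n`-th differential of a polynomial in the `n`-th power of
the vanishing ideal. -/
theorem exists_taylor_eq_of_isLeading (e : AveragingFamily Y) :
    ∀ (n : ℕ) (f : MultilinearMap k (fun _ : Fin n => Point k g s) (Matrix (Fin s) (Fin s) k)),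
      IsLeading Y f →
      ∃ q ∈ vanishingIdeal Y ^ n, ∀ z, (taylor Y q).app n z = f (fun i => z i) := by
  intro n
  induction n with
  | zero =>
    intro f hf
    have hconst : ∀ z : ℕ → Point k g s, f (fun i => z i) = f ![] :=
      fun z => congrArg f (Subsingleton.elim _ _)
    have hc : ∀ c, (∀ j, c * Y j = Y j * c) → c * f ![] = f ![] * c := by
      intro c hc
      have := hf.balanced 0 le_rfl c hc fun _ => 0
      rwa [if_pos rfl, if_pos rfl, hconst fun _ => 0] at this
    obtain ⟨q, hq⟩ := e.mean_mem (f ![])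
    refine ⟨q, by rw [Submodule.pow_zero, Ideal.one_eq_top]; trivial, fun z => ?_⟩
    rw [taylor_app_zero, hq, hconst]
    exact e.mean_eq_self hc
  | succ n ih =>
    intro f hf
    obtain ⟨Q, hQ0, hQl, hQr, hQ⟩ := e.exists_projection
    choose q hq hq' using fun j r => ih _ (e.isLeading_tailCoeff hf j r)
    have hhead : ∀ (j : Fin g) (r : Fin s × Fin s × Fin s), ∃ h ∈ vanishingIdeal Y,
        ∀ z, (taylor Y h).app 1 z = e.mean (Matrix.single r.2.2 r.1 1) * Q j (z 0) := by
      intro j r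
      refine e.exists_taylor_one
        (φ := LinearMap.mulLeft k (e.mean (Matrix.single r.2.2 r.1 1)) ∘ₗ Q j)
        (fun c hc Z => ?_) (fun c hc Z => ?_) fun S => ?_
      · simp only [LinearMap.comp_apply, LinearMap.mulLeft_apply, hQl j c hc, ← mul_assoc,
          e.mul_mean hc]
      · simp only [LinearMap.comp_apply, LinearMap.mulLeft_apply, hQr j c hc, ← mul_assoc]
      · simp only [LinearMap.comp_apply, LinearMap.mulLeft_apply, hQ0, mul_zero]
    choose h hh hh' using hhead
    refine ⟨∑ j, ∑ r, h j r * q j r, ?_, fun z => ?_⟩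
    · rw [Ideal.IsTwoSided.pow_succ]
      exact sum_mem fun j _ => sum_mem fun r _ => Ideal.mul_mem_mul (hh j r) (hq j r)
    · let L : FreeAlgebra k (Fin g) →+ Matrix (Fin s) (Fin s) k :=
        { toFun := fun p => (taylor Y p).app (n + 1) z
          map_zero' := by rw [map_zero, MultiSeq.app_zero]
          map_add' := fun x y => by rw [map_add, MultiSeq.app_add] }
      have hL : ∀ j r, L (h j r * q j r) = e.mean (Matrix.single r.2.2 r.1 1) * Q j (z 0) *
          e.tailCoeff f j r (fun i => z (i + 1)) := by
        intro j r
        have h1 := taylor_app_eq_zero_of_mem_pow Y 1 (h j r)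
          (by rw [Submodule.pow_one]; exact hh j r)
        change (taylor Y _).app (n + 1) z = _
        rw [map_mul, MultiSeq.app_mul_of_order h1 (taylor_app_eq_zero_of_mem_pow Y n _ (hq j r))
          (n + 1) (by omega), if_pos (add_comm _ _), hh', ← hq' j r (fun i => z (i + 1))]
        simp only [add_comm 1]
      change L _ = _
      simp only [map_sum, hL]
      -- Replacing the first argument by its projection changes it by some [S, Y], which f does not
      -- see.
      obtain ⟨S, hS⟩ := hQ (z 0)
      rw [e.sum_mean_mul_tailCoeff hf (fun j => Q j (z 0)) fun i => z (i + 1)]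
      generalize (fun j => Q j (z 0)) = W at hS ⊢
      have h2 : f (fun i => z i) = f (fun i => ins 0 (z 0) (fun i => z (i + 1)) i) := by
        rw [ins_zero_self]
      have h3 := hf.vanish 0 (Nat.succ_pos n) S (ins 0 (comm S Y) fun i => z (i + 1))
        (ins_zero_zero _ _)
      rw [h2, hS, ← sum_headMap]
      rw [← sum_headMap] at h3 ⊢
      simp only [Pi.add_apply, map_add, Finset.sum_add_distrib, h3, add_zero]

end AveragingFamily

/-- The term of lowest degree of a germ is a leading term. -/
theorem LAC.isLeading {f : MultiSeq k (Point k g s) (Matrix (Fin s) (Fin s) k)} (hf : LAC Y f)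
    {n : ℕ} (h0 : ∀ m < n, ∀ z, f.app m z = 0) : IsLeading Y (f n) := by
  rw [lac_iff_app] at hf
  refine ⟨fun p hp S z hz => ?_, fun p hp c hc z => ?_⟩
  · obtain ⟨n, rfl⟩ : ∃ m, n = m + 1 := ⟨n - 1, by omega⟩
    have hz' : z = ins p (comm S Y) (fun i => if i < p then z i else z (i + 1)) := by
      funext i
      unfold ins
      split_ifs with h1 h2
      · exact (if_pos h1).symm
      · rw [h2, hz]
      · beta_reduce
        rw [if_neg (by omega), show i - 1 + 1 = i by omega]
    change f.app (n + 1) z = 0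
    rw [hz', hf n p (by omega)]
    simp only [h0 n (Nat.lt_succ_self n), mul_zero, zero_mul, ite_self, sub_zero]
  · have h := hf n p hp c z
    -- For S = c in the centralizer the inserted argument is zero, so the two sides of the
    -- intertwining condition agree.
    have hcY : comm c Y = 0 := funext fun j => sub_eq_zero.2 (hc j)
    have hz : f.app (n + 1) (ins p (comm c Y) z) = 0 := by
      refine (f (n + 1)).map_coord_zero (⟨p, by omega⟩ : Fin (n + 1)) ?_
      simp [ins, hcY]
    rw [hz] at h
    exact sub_eq_zero.1 h.symm

/-- Up to any order, a germ about a semisimple point is the germ of a polynomial. -/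
theorem exists_taylor_eq [CharZero k] (hY : IsSemisimplePoint Y)
    {f : MultiSeq k (Point k g s) (Matrix (Fin s) (Fin s) k)} (hf : LAC Y f) (ℓ : ℕ) :
    ∃ p, ∀ m < ℓ, ∀ z, (taylor Y p).app m z = f.app m z := by
  obtain ⟨e⟩ := hY.nonempty_averagingFamily
  induction ℓ with
  | zero => exact ⟨0, fun m hm => absurd hm (Nat.not_lt_zero m)⟩
  | succ ℓ ih =>
    obtain ⟨p, hp⟩ := ih
    have hsub : LAC Y (f - taylor Y p) := (formalGerms Y).sub_mem hf (taylor_mem Y p)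
    have happ : ∀ m z, (f - taylor Y p).app m z = f.app m z - (taylor Y p).app m z :=
      fun _ _ => rfl
    -- Since q lies in the ℓ-th power, it corrects degree ℓ without disturbing lower degrees.
    obtain ⟨q, hq, hq'⟩ := e.exists_taylor_eq_of_isLeading ℓ _
      (hsub.isLeading fun m hm z => by rw [happ, hp m hm, sub_self])
    refine ⟨p + q, fun m hm z => ?_⟩
    rw [map_add, MultiSeq.app_add]
    rcases Nat.lt_succ_iff_lt_or_eq.1 hm with h | rfl
    · rw [hp m h, taylor_app_eq_zero_of_mem_pow Y ℓ q hq m h, add_zero]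
    · rw [hq' z]
      change _ + (f - taylor Y p).app m z = _
      rw [happ, add_sub_cancel]

end Leading

/-! ### Formal germs as the completion of the free algebra -/

section Completion

variable {k : Type*} [Field k] {g s : ℕ} {Y : Point k g s}

theorem mk_eq_mk_iff (ℓ : ℕ) (p q : FreeAlgebra k (Fin g)) :
    Ideal.Quotient.mk (vanishingIdeal Y ^ ℓ) p = Ideal.Quotient.mk (vanishingIdeal Y ^ ℓ) q ↔
      ∀ m < ℓ, ∀ z, (taylor Y p).app m z = (taylor Y q).app m z := by
  rw [Ideal.Quotient.eq, mem_pow_iff]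
  have : ∀ m z, (taylor Y (p - q)).app m z = (taylor Y p).app m z - (taylor Y q).app m z := by
    intro m z
    rw [map_sub]
    rfl
  simp only [this, sub_eq_zero]

theorem exists_formalGerms_algEquiv [CharZero k] (hY : IsSemisimplePoint Y) :
    ∃ Φ : formalGerms Y ≃ₐ[k] powerCompletion (k := k) (vanishingIdeal Y),
      ∀ (f : formalGerms Y) (ℓ : ℕ) (p : FreeAlgebra k (Fin g)),
        (Φ f).1 ℓ = Ideal.Quotient.mk (vanishingIdeal Y ^ ℓ) p ↔
          ∀ m < ℓ, ∀ z, f.1.app m z = (taylor Y p).app m z := by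
  choose P hP using fun (f : formalGerms Y) (ℓ : ℕ) => exists_taylor_eq hY f.2 ℓ
  let φ : formalGerms Y → powerCompletion (k := k) (vanishingIdeal Y) := fun f =>
    ⟨fun ℓ => Ideal.Quotient.mk _ (P f ℓ), fun m n h => by
      rw [Ideal.Quotient.factor_mk, mk_eq_mk_iff]
      intro i hi z
      rw [hP f n i (by omega), hP f m i hi]⟩
  have hφ : ∀ f ℓ p, (φ f).1 ℓ = Ideal.Quotient.mk (vanishingIdeal Y ^ ℓ) p ↔
      ∀ m < ℓ, ∀ z, f.1.app m z = (taylor Y p).app m z := by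
    intro f ℓ p
    refine (mk_eq_mk_iff ℓ _ _).trans ?_
    refine forall_congr' fun m => forall_congr' fun hm => forall_congr' fun z => ?_
    rw [hP f ℓ m hm]
  let Φ : formalGerms Y →ₐ[k] powerCompletion (k := k) (vanishingIdeal Y) :=
    { toFun := φ
      map_one' := Subtype.ext <| funext fun ℓ => (hφ 1 ℓ 1).2 fun m _ z => by
        rw [map_one]; rfl
      map_zero' := Subtype.ext <| funext fun ℓ => (hφ 0 ℓ 0).2 fun m _ z => by
        rw [map_zero]; rfl
      map_mul' := fun a b => Subtype.ext <| funext fun ℓ =>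
        (hφ (a * b) ℓ (P a ℓ * P b ℓ)).2 fun m hm z => by
          rw [map_mul, MultiSeq.app_mul]
          change (a.1 * b.1).app m z = _
          rw [MultiSeq.app_mul]
          refine Finset.sum_congr rfl fun i hi => ?_
          have := Finset.mem_range.1 hi
          rw [hP a ℓ i (by omega), hP b ℓ (m - i) (by omega)]
      map_add' := fun a b => Subtype.ext <| funext fun ℓ =>
        (hφ (a + b) ℓ (P a ℓ + P b ℓ)).2 fun m hm z => by
          rw [map_add, MultiSeq.app_add, hP a ℓ m hm, hP b ℓ m hm]
          rfl
      commutes' := fun c => Subtype.ext <| funext fun ℓ =>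
        (hφ (algebraMap k _ c) ℓ (algebraMap k _ c)).2 fun m _ z => by
          rw [AlgHom.commutes]; rfl }
  have hbij : Function.Bijective Φ := by
    constructor
    · intro a b hab
      refine Subtype.ext (MultiSeq.ext_app fun n z => ?_)
      have h1 : (φ a).1 (n + 1) = Ideal.Quotient.mk _ (P b (n + 1)) :=
        congrArg (fun x => x.1 (n + 1)) hab
      rw [(hφ a _ _).1 h1 n (Nat.lt_succ_self n), hP b _ n (Nat.lt_succ_self n)]
    · intro x
      choose p hp using fun ℓ => Ideal.Quotient.mk_surjective (x.1 ℓ)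
      have hcompat : ∀ m n, m ≤ n → ∀ i < m, ∀ z,
          (taylor Y (p n)).app i z = (taylor Y (p m)).app i z := by
        intro m n hmn
        rw [← mk_eq_mk_iff, hp m, ← x.2 m n hmn, ← hp n, Ideal.Quotient.factor_mk]
      -- The class modulo the power m + 1 is the first to determine the term of degree m.
      let F : MultiSeq k (Point k g s) (Matrix (Fin s) (Fin s) k) :=
        fun m => taylor Y (p (m + 1)) m
      have hF : ∀ m n, m < n → ∀ z, F.app m z = (taylor Y (p n)).app m z :=
        fun m n hmn z => (hcompat (m + 1) n hmn m (Nat.lt_succ_self m) z).symm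
      have hLAC : LAC Y F := by
        rw [lac_iff_app]
        intro n q hq S z
        -- The condition involves degrees n and n + 1 only, both computed by this one polynomial
        -- germ.
        have := (lac_iff_app Y _).1 (taylor_mem Y (p (n + 2))) n q hq S z
        simpa only [← hF (n + 1) (n + 2) (by omega), ← hF n (n + 2) (by omega)] using this
      refine ⟨⟨F, hLAC⟩, Subtype.ext <| funext fun ℓ => ?_⟩
      rw [← hp ℓ]
      exact (hφ ⟨F, hLAC⟩ ℓ (p ℓ)).2 fun m hm z => hF m ℓ hm z
  exact ⟨AlgEquiv.ofBijective Φ hbij, hφ⟩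

theorem forall_app_eq_ncDiff_iff (f : MultiSeq k (Point k g s) (Matrix (Fin s) (Fin s) k))
    (p : FreeAlgebra k (Fin g)) (m : ℕ) :
    (∀ z, f.app m z = (taylor Y p).app m z) ↔
      ∀ Z : Fin m → Point k g s, f m Z = ncDiff Y p m Z := by
  constructor
  · intro h Z
    obtain ⟨z, rfl⟩ := exists_seq Z
    rw [ncDiff_eq]
    exact h z
  · intro h z
    rw [← ncDiff_eq]
    exact h _

end Completion

end FreeAnalysis

theorem theoremE {k : Type*} [Field k] [CharZero k] {g s : ℕ} (Y : FreeAnalysis.Point k g s)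
    (hY : FreeAnalysis.IsSemisimplePoint Y) :
    (∀ ℓ : ℕ, FreeAnalysis.higherVanishingIdeal Y ℓ =
      FreeAnalysis.vanishingIdeal Y ^ (ℓ + 1)) ∧
    ∃ Φ : FreeAnalysis.formalGerms Y ≃ₐ[k]
        FreeAnalysis.powerCompletion (k := k) (FreeAnalysis.vanishingIdeal Y),
      ∀ (f : FreeAnalysis.formalGerms Y) (ℓ : ℕ) (p : FreeAlgebra k (Fin g)),
        (Φ f).1 ℓ = Ideal.Quotient.mk (FreeAnalysis.vanishingIdeal Y ^ ℓ) p ↔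
          ∀ m < ℓ, ∀ Z : Fin m → FreeAnalysis.Point k g s,
            f.1 m Z = FreeAnalysis.ncDiff Y p m Z := by
  refine ⟨FreeAnalysis.higherVanishingIdeal_eq_pow Y, ?_⟩
  obtain ⟨Φ, hΦ⟩ := FreeAnalysis.exists_formalGerms_algEquiv hY
  refine ⟨Φ, fun f ℓ p => (hΦ f ℓ p).trans ?_⟩
  simp only [FreeAnalysis.forall_app_eq_ncDiff_iff]
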